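/- Let $d,B\ge 1$ be integers, $\beta\in\mathbb R$, and let $Y_1,\dots,Y_B$ be i.i.d. random vectors in $\mathbb{R}^d$ with $\mathbb{E}[Y_i]=0$, $\mathbb{E}[Y_iY_i^{\top}]=\Sigma_Y$ and $\|Y_i\|\le\beta$ almost surely ($\|\cdot\|$ being the Euclidean norm). Let $Y=\frac{1}{\sqrt B}\sum_{i=1}^{B}Y_i$, and let $X,Z$ be i.i.d. $\mathcal N(0,I)$ random vectors in $\mathbb{R}^d$, independent of $Y_1,\dots,Y_B$. Suppose that $\beta^2\le \frac15$ and $\|\Sigma_Y\|_2\le\frac{1}{5d}$, where $\|\cdot\|_2$ is the spectral norm. Then $$W_2^2\bigl(\sqrt{I-\Sigma_Y}\,X+Y,\;Z\bigr)\;\le\;\frac{25\,\beta^6\,d\,(1+\log B)^2}{B}.$$ Here $\sqrt{I-\Sigma_Y}$ is the positive semidefinite square root, and $W_2(U,V)$ denotes the 2-Wasserstein distance between the laws $\mu,\nu$ of $U,V$ with respect to the Euclidean metric: $W_2^2(U,V)=\inf_\pi\int\|x-y\|^2\,d\pi(x,y)$, the infimum being over all couplings $\pi$ of $\mu$ and $\nu$.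 -/

import Mathlib

open MeasureTheory ProbabilityTheory
open scoped ENNReal MatrixOrder

/-- `π` is a coupling of `μ` and `ν`: its marginals are `μ` and `ν`. -/
def IsCoupling {E : Type*} [MeasurableSpace E] (π : Measure (E × E)) (μ ν : Measure E) : Prop :=
  π.fst = μ ∧ π.snd = ν

/-- The `p`-Wasserstein distance `(inf_π ∫ d(x, y)^p dπ(x, y))^{1/p}`, the infimum being over all
couplings `π` of `μ` and `ν`, with values in `[0, ∞]`. -/
noncomputable def wassersteinDist {E : Type*} [PseudoEMetricSpace E] [MeasurableSpace E]
    (p : ℝ) (μ ν : Measure E) : ℝ≥0∞ :=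
  (⨅ (π : Measure (E × E)) (_ : IsCoupling π μ ν), ∫⁻ z, edist z.1 z.2 ^ p ∂π) ^ (1 / p)

/-!
The summands are exchanged for Gaussian vectors one at a time, as in Lindeberg's method, but in the
Wasserstein distance itself and without any smoothness of the laws involved.

In an eigenbasis of `S` the vector `√(1 - S) X` has independent Gaussian coordinates, so every
covariance matrix may be taken diagonal (`map_repr_multivariateGaussian`). Let `s` be the covariance
of a single summand `V = Y i / √B`. Since `‖S‖` is at most `β ^ 2`, every intermediate Gaussian
component has variances in `[4 / 5, 1]`. One step of the exchange therefore compares the law of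
`ξ + V` with a Gaussian law of covariance `m`, where `ξ` is Gaussian of covariance `m - s`; the
remaining summands are added to both sides and do not increase the cost. The triangle inequality,
proved by gluing couplings (`CoupledWithin.trans`), adds up the costs of the `B` steps
(`coupledWithin_sum`).

The cost of one step (`coupledWithin_exchange`) is bounded by relative entropy. After normalising
the reference measure to the standard Gaussian measure `γ`, two facts are needed.

* Talagrand's inequality `W₂(μ, γ) ^ 2 ≤ 2 KL(μ | γ)` for bounded mixtures `μ` of translates of a
  Gaussian measure (`exists_coupling_gaussMix_le_klDiv`). On the line it holds because the monotone
  transport map `T` satisfies `p (T x) T' x = φ x`, which makes the integrand of the relative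
  entropy exceed `(T x - x) ^ 2 / 2` up to an exact derivative
  (`HasPosDensity.lintegral_sq_gaussTransport_le`). In higher dimension the coordinates are coupled
  successively, the chain rule for relative entropy accounting for the sum of the costs. This
  applies since the conditional laws of a bounded Gaussian mixture are bounded Gaussian mixtures,
  mixed by the posterior law (`exists_disintegration_gaussMix`).

* The estimate `KL ≤ t ^ 3` when the mixing vector is centred, has the covariance of the Gaussian
  component that it replaces, and has squared norm at most `t ≤ 1 / 4` (`klDiv_gaussMix_le`). The
  relative entropy is at most the `χ²`-divergence, and `1 + χ²` is the expectation of a product of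
  Mehler kernels over two independent copies of the mixing vector (`lintegral_mixRatio_sq`). When
  this product is expanded, the terms of orders one and two cancel because the first two moments
  match (`lintegral_prod_mehler_le`).

With `t = 5 β ^ 2 / (4 B)` each step costs at most `√(2 t ^ 3)`, and `(B √(2 t ^ 3)) ^ 2` equals
`(125 / 32) β ^ 6 / B`.
-/

open Filter Topology Set InformationTheory

/-! ### Monotone transport of the Gaussian measure on the line -/

/-- The generalised inverse of the distribution function of `μ`. -/
noncomputable def quantile (μ : Measure ℝ) (u : ℝ) : ℝ := sInf {t | u ≤ cdf μ t}

/-- The adjunction between the quantile function and the distribution function, which is valid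
without continuity of the latter because it is right-continuous. -/
theorem quantile_le_iff (μ : Measure ℝ) {u : ℝ} (h0 : 0 < u) (h1 : u < 1) (t : ℝ) :
    quantile μ u ≤ t ↔ u ≤ cdf μ t := by
  have hbdd : BddBelow {t | u ≤ cdf μ t} := by
    obtain ⟨a, ha⟩ := ((tendsto_cdf_atBot μ).eventually (gt_mem_nhds h0)).exists
    refine ⟨a, fun t ht => ?_⟩
    by_contra hlt
    exact absurd (ht.trans (monotone_cdf μ (not_le.1 hlt).le)) (not_le.2 ha)
  have hne : {t | u ≤ cdf μ t}.Nonempty := by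
    obtain ⟨a, ha⟩ := ((tendsto_cdf_atTop μ).eventually (lt_mem_nhds h1)).exists
    exact ⟨a, ha.le⟩
  constructor
  · intro h
    have key : ∀ s, t < s → u ≤ cdf μ s := by
      intro s hs
      obtain ⟨r, hr, hrs⟩ := exists_lt_of_csInf_lt hne (h.trans_lt hs)
      exact hr.trans (monotone_cdf μ hrs.le)
    have hc : Tendsto (cdf μ) (𝓝[>] t) (𝓝 (cdf μ t)) :=
      ((cdf μ).right_continuous t).tendsto.mono_left (nhdsWithin_mono _ Ioi_subset_Ici_self)
    exact ge_of_tendsto hc (eventually_nhdsWithin_of_forall key)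
  · intro h
    exact csInf_le hbdd h

/-- `μ` has the continuous, everywhere positive Lebesgue density `p`. -/
structure HasPosDensity (μ : Measure ℝ) (p : ℝ → ℝ) : Prop where
  cont : Continuous p
  pos : ∀ x, 0 < p x
  eq : μ = volume.withDensity fun x => ENNReal.ofReal (p x)

namespace HasPosDensity

variable {μ : Measure ℝ} [IsProbabilityMeasure μ] {p : ℝ → ℝ}

theorem integrable (h : HasPosDensity μ p) : Integrable p := by
  refine (lintegral_ofReal_ne_top_iff_integrable h.cont.aestronglyMeasurable
    (ae_of_all _ fun x => (h.pos x).le)).1 ?_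
  have : μ univ = ∫⁻ x, ENNReal.ofReal (p x) := by
    rw [h.eq, withDensity_apply _ MeasurableSet.univ, Measure.restrict_univ]
  rw [← this]; simp

theorem cdf_eq (h : HasPosDensity μ p) (x : ℝ) : cdf μ x = ∫ t in Iic x, p t := by
  rw [cdf_eq_real, measureReal_def, h.eq, withDensity_apply _ measurableSet_Iic,
    ← ofReal_integral_eq_lintegral_ofReal h.integrable.integrableOn
      (ae_of_all _ fun x => (h.pos x).le), ENNReal.toReal_ofReal]
  exact integral_nonneg fun x => (h.pos x).le

theorem hasDerivAt_cdf (h : HasPosDensity μ p) (x : ℝ) : HasDerivAt (cdf μ) (p x) x := by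
  have : (cdf μ : ℝ → ℝ) = fun x => (∫ t in Iic 0, p t) + ∫ t in (0:ℝ)..x, p t := by
    funext y
    rw [h.cdf_eq, ← intervalIntegral.integral_Iic_sub_Iic h.integrable.integrableOn
      h.integrable.integrableOn]
    ring
  rw [this]
  exact (intervalIntegral.integral_hasDerivAt_right (h.cont.intervalIntegrable _ _)
    (h.cont.stronglyMeasurableAtFilter _ _) h.cont.continuousAt).const_add _

theorem continuous_cdf (h : HasPosDensity μ p) : Continuous (cdf μ) :=
  continuous_iff_continuousAt.2 fun x => (h.hasDerivAt_cdf x).continuousAt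

theorem strictMono_cdf (h : HasPosDensity μ p) : StrictMono (cdf μ) :=
  strictMono_of_deriv_pos fun x => by rw [(h.hasDerivAt_cdf x).deriv]; exact h.pos x

theorem cdf_pos (h : HasPosDensity μ p) (x : ℝ) : 0 < cdf μ x :=
  (cdf_nonneg μ (x - 1)).trans_lt (h.strictMono_cdf (by linarith))

theorem cdf_lt_one (h : HasPosDensity μ p) (x : ℝ) : cdf μ x < 1 :=
  (h.strictMono_cdf (by linarith : x < x + 1)).trans_le (cdf_le_one μ (x + 1))

theorem cdf_quantile (h : HasPosDensity μ p) {u : ℝ} (h0 : 0 < u) (h1 : u < 1) :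
    cdf μ (quantile μ u) = u := by
  apply le_antisymm
  · have hc : Tendsto (cdf μ) (𝓝[<] quantile μ u) (𝓝 (cdf μ (quantile μ u))) :=
      h.continuous_cdf.continuousAt.tendsto.mono_left nhdsWithin_le_nhds
    refine le_of_tendsto hc (eventually_nhdsWithin_of_forall fun t ht => ?_)
    by_contra hlt
    exact absurd ((quantile_le_iff μ h0 h1 t).2 (not_le.1 hlt).le) (not_le.2 ht)
  · exact (quantile_le_iff μ h0 h1 _).1 le_rfl

theorem quantile_cdf (h : HasPosDensity μ p) (y : ℝ) : quantile μ (cdf μ y) = y :=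
  h.strictMono_cdf.injective (h.cdf_quantile (h.cdf_pos y) (h.cdf_lt_one y))

theorem hasDerivAt_quantile (h : HasPosDensity μ p) {u : ℝ} (h0 : 0 < u) (h1 : u < 1) :
    HasDerivAt (quantile μ) (p (quantile μ u))⁻¹ u := by
  have hnhds : Ioo (0 : ℝ) 1 ∈ 𝓝 u := Ioo_mem_nhds h0 h1
  have hmono : StrictMonoOn (quantile μ) (Ioo 0 1) := by
    intro a ha b hb hab
    by_contra hle
    have := (quantile_le_iff μ hb.1 hb.2 _).1 (not_lt.1 hle)
    rw [h.cdf_quantile ha.1 ha.2] at this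
    exact absurd hab (not_lt.2 this)
  have himg : quantile μ '' Ioo 0 1 = univ :=
    eq_univ_of_forall fun y => ⟨cdf μ y, ⟨h.cdf_pos y, h.cdf_lt_one y⟩, h.quantile_cdf y⟩
  refine HasDerivAt.of_local_left_inverse
    (hmono.continuousAt_of_image_mem_nhds hnhds (by rw [himg]; exact univ_mem))
    (h.hasDerivAt_cdf _) (h.pos _).ne' ?_
  filter_upwards [hnhds] with v hv using h.cdf_quantile hv.1 hv.2

end HasPosDensity

theorem hasPosDensity_gaussianReal (m : ℝ) {w : NNReal} (hw : w ≠ 0) :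
    HasPosDensity (gaussianReal m w) (gaussianPDFReal m w) where
  cont := by unfold gaussianPDFReal; fun_prop
  pos x := gaussianPDFReal_pos m w x hw
  eq := by rw [gaussianReal_of_var_ne_zero m hw]; rfl

/-- The monotone map transporting the standard Gaussian measure on `ℝ` to `μ`. -/
noncomputable def gaussTransport (μ : Measure ℝ) (x : ℝ) : ℝ :=
  quantile μ (cdf (gaussianReal 0 1) x)

theorem gaussTransport_le_iff (μ : Measure ℝ) (x t : ℝ) :
    gaussTransport μ x ≤ t ↔ cdf (gaussianReal 0 1) x ≤ cdf μ t :=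
  quantile_le_iff μ ((hasPosDensity_gaussianReal 0 one_ne_zero).cdf_pos x)
    ((hasPosDensity_gaussianReal 0 one_ne_zero).cdf_lt_one x) t

/-- Joint measurability of the monotone maps to the laws of a kernel, which allows couplings to be
composed along the kernel. -/
theorem measurable_gaussTransport_uncurry {α : Type*} [MeasurableSpace α] (κ : Kernel α ℝ)
    [IsMarkovKernel κ] : Measurable fun q : α × ℝ => gaussTransport (κ q.1) q.2 := by
  refine measurable_of_Iic fun t => ?_
  have : (fun q : α × ℝ => gaussTransport (κ q.1) q.2) ⁻¹' Iic t
      = {q : α × ℝ | cdf (gaussianReal 0 1) q.2 ≤ cdf (κ q.1) t} := by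
    ext q; exact gaussTransport_le_iff _ _ _
  rw [this]
  refine measurableSet_le ((monotone_cdf _).measurable.comp measurable_snd) ?_
  simp_rw [cdf_eq_real, measureReal_def]
  exact ((Kernel.measurable_coe κ measurableSet_Iic).comp measurable_fst).ennreal_toReal

theorem measurable_gaussTransport (μ : Measure ℝ) [IsProbabilityMeasure μ] :
    Measurable (gaussTransport μ) :=
  (measurable_gaussTransport_uncurry (Kernel.const Unit μ)).comp
    (measurable_const (a := ()) |>.prodMk measurable_id)

theorem HasPosDensity.map_gaussTransport {μ : Measure ℝ} [IsProbabilityMeasure μ] {p : ℝ → ℝ}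
    (h : HasPosDensity μ p) : (gaussianReal 0 1).map (gaussTransport μ) = μ := by
  have hg := hasPosDensity_gaussianReal 0 one_ne_zero
  have := Measure.isProbabilityMeasure_map (μ := gaussianReal 0 1)
    (measurable_gaussTransport μ).aemeasurable
  refine Measure.eq_of_cdf _ _ ?_
  ext t
  set x := quantile (gaussianReal 0 1) (cdf μ t) with hx
  have hxt : cdf (gaussianReal 0 1) x = cdf μ t := hg.cdf_quantile (h.cdf_pos t) (h.cdf_lt_one t)
  have hpre : gaussTransport μ ⁻¹' Iic t = Iic x := by
    ext y
    simp only [mem_preimage, mem_Iic, gaussTransport_le_iff, ← hxt]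
    exact hg.strictMono_cdf.le_iff_le
  rw [cdf_eq_real, measureReal_def, Measure.map_apply (measurable_gaussTransport μ)
    measurableSet_Iic, hpre, ← measureReal_def, ← cdf_eq_real, hxt]

theorem HasPosDensity.hasDerivAt_gaussTransport {μ : Measure ℝ} [IsProbabilityMeasure μ]
    {p : ℝ → ℝ} (h : HasPosDensity μ p) (x : ℝ) :
    HasDerivAt (gaussTransport μ) (gaussianPDFReal 0 1 x / p (gaussTransport μ x)) x := by
  have hg := hasPosDensity_gaussianReal 0 one_ne_zero
  have := (h.hasDerivAt_quantile (hg.cdf_pos x) (hg.cdf_lt_one x)).comp x (hg.hasDerivAt_cdf x)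
  rw [div_eq_inv_mul]
  exact this

theorem integrable_gaussianReal_iff {f : ℝ → ℝ} :
    Integrable f (gaussianReal 0 1) ↔ Integrable fun x => gaussianPDFReal 0 1 x * f x := by
  rw [gaussianReal_of_var_ne_zero 0 one_ne_zero, gaussianPDF_def,
    integrable_withDensity_iff_integrable_smul₀'
      (measurable_gaussianPDFReal 0 1).ennreal_ofReal.aemeasurable
      (ae_of_all _ fun _ => ENNReal.ofReal_lt_top)]
  refine integrable_congr (ae_of_all _ fun x => ?_)
  simp [ENNReal.toReal_ofReal (gaussianPDFReal_nonneg 0 1 x)]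

theorem hasDerivAt_gaussianPDFReal (x : ℝ) :
    HasDerivAt (gaussianPDFReal 0 1) (-x * gaussianPDFReal 0 1 x) x := by
  have h1 : HasDerivAt (fun y : ℝ => -(y - 0) ^ 2 / (2 * ((1 : NNReal) : ℝ))) (-x) x := by
    have := (((hasDerivAt_id x).sub_const 0).pow 2).neg.div_const (2 * ((1 : NNReal) : ℝ))
    refine this.congr_deriv ?_
    simp
    ring
  have h2 := h1.exp.const_mul (√(2 * Real.pi * ((1 : NNReal) : ℝ)))⁻¹
  refine h2.congr_deriv ?_
  simp only [gaussianPDFReal]; ring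

/-- Controls the boundary terms in the integration by parts against the Gaussian density. -/
theorem tendsto_linear_mul_gaussianPDFReal (c : ℝ) :
    Tendsto (fun R : ℝ => (2 * R + c) * gaussianPDFReal 0 1 R) atTop (𝓝 0) := by
  have h1 : Tendsto (fun R : ℝ => 2 * (R ^ 1 * Real.exp (-R)) + c * Real.exp (-R)) atTop
      (𝓝 (2 * 0 + c * 0)) :=
    ((Real.tendsto_pow_mul_exp_neg_atTop_nhds_zero 1).const_mul 2).add
      (Real.tendsto_exp_neg_atTop_nhds_zero.const_mul c)
  have h2 : Tendsto (fun R : ℝ => Real.exp (-(R - 2) * R / 2)) atTop (𝓝 0) := by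
    refine Real.tendsto_exp_atBot.comp ?_
    have : Tendsto (fun R : ℝ => (R - 2) * R / 2) atTop atTop :=
      ((tendsto_atTop_add_const_right _ (-2) tendsto_id).atTop_mul_atTop₀
        tendsto_id).atTop_div_const two_pos
    refine (tendsto_neg_atTop_atBot.comp this).congr fun R => ?_
    simp; ring
  have h3 := (h1.mul h2).const_mul (√(2 * Real.pi))⁻¹
  simp only [mul_zero, add_zero] at h3
  refine h3.congr fun R => ?_
  have : Real.exp (-R ^ 2 / 2) = Real.exp (-R) * Real.exp (-(R - 2) * R / 2) := by
    rw [← Real.exp_add]; congr 1; ring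
  simp only [gaussianPDFReal, sub_zero, NNReal.coe_one, mul_one, this]
  ring

theorem HasPosDensity.eq_withDensity_gaussianReal {μ : Measure ℝ} {p : ℝ → ℝ}
    (h : HasPosDensity μ p) : μ = (gaussianReal 0 1).withDensity
      fun x => ENNReal.ofReal (p x / gaussianPDFReal 0 1 x) := by
  have hg := hasPosDensity_gaussianReal 0 one_ne_zero
  have hm : Measurable fun x => p x / gaussianPDFReal 0 1 x :=
    h.cont.measurable.div hg.cont.measurable
  rw [hg.eq, ← withDensity_mul _ hg.cont.measurable.ennreal_ofReal hm.ennreal_ofReal]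
  conv_lhs => rw [h.eq]
  congr 1
  funext x
  simp only [Pi.mul_apply]
  rw [← ENNReal.ofReal_mul (hg.pos x).le, mul_div_cancel₀ _ (hg.pos x).ne']

/-- Pointwise form of Talagrand's inequality on the line: the integrand of the relative entropy
dominates half the squared displacement up to an exact derivative. -/
theorem sq_displacement_le {a b : ℝ} (ha : 0 < a) (hb : 0 < b) (y t : ℝ)
    (hab : a / gaussianPDFReal 0 1 t * b = gaussianPDFReal 0 1 y / gaussianPDFReal 0 1 t) :
    (t - y) ^ 2 / 2 ≤ Real.log (a / gaussianPDFReal 0 1 t) + (b - 1 - y * (t - y)) := by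
  have hφ : ∀ z, 0 < gaussianPDFReal 0 1 z := fun z => gaussianPDFReal_pos 0 1 z one_ne_zero
  have h1 : Real.log (a / gaussianPDFReal 0 1 t) + Real.log b
      = Real.log (gaussianPDFReal 0 1 y / gaussianPDFReal 0 1 t) := by
    rw [← hab, Real.log_mul (div_pos ha (hφ t)).ne' hb.ne']
  have h2 : Real.log (gaussianPDFReal 0 1 y / gaussianPDFReal 0 1 t) = (t ^ 2 - y ^ 2) / 2 := by
    have : gaussianPDFReal 0 1 y / gaussianPDFReal 0 1 t = Real.exp ((t ^ 2 - y ^ 2) / 2) := by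
      rw [div_eq_iff (hφ t).ne']
      simp only [gaussianPDFReal, sub_zero, NNReal.coe_one, mul_one]
      rw [mul_left_comm, ← Real.exp_add]
      congr 2; ring
    rw [this, Real.log_exp]
  have h3 := Real.log_le_sub_one_of_pos hb
  nlinarith

/-- Talagrand's transport inequality on the line. The cost of the monotone transport map from the
standard Gaussian measure is at most twice the relative entropy. -/
theorem HasPosDensity.lintegral_sq_gaussTransport_le {μ : Measure ℝ} [IsProbabilityMeasure μ]
    {p : ℝ → ℝ} (h : HasPosDensity μ p) {c : ℝ} (hc : ∀ x, |gaussTransport μ x| ≤ |x| + c) :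
    ∫⁻ x, ENNReal.ofReal ((gaussTransport μ x - x) ^ 2) ∂(gaussianReal 0 1)
      ≤ 2 * klDiv μ (gaussianReal 0 1) := by
  by_cases hkl : klDiv μ (gaussianReal 0 1) = ∞
  · rw [hkl]; simp
  obtain ⟨hac, hllr⟩ := klDiv_ne_top_iff.1 hkl
  have hg := hasPosDensity_gaussianReal 0 one_ne_zero
  set φ := gaussianPDFReal 0 1 with hφ
  set T := gaussTransport μ with hT
  have hTc : Continuous T :=
    continuous_iff_continuousAt.2 fun x => (h.hasDerivAt_gaussTransport x).continuousAt
  have hpc : Continuous fun y => p y / φ y := h.cont.div hg.cont fun x => (hg.pos x).ne'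
  have hlog : llr μ (gaussianReal 0 1) =ᵐ[μ] fun y => Real.log (p y / φ y) := by
    have : μ.rnDeriv (gaussianReal 0 1) =ᵐ[gaussianReal 0 1]
        fun x => ENNReal.ofReal (p x / φ x) := by
      conv_lhs => rw [h.eq_withDensity_gaussianReal]
      exact Measure.rnDeriv_withDensity _ hpc.measurable.ennreal_ofReal
    filter_upwards [hac.ae_eq this] with x hx
    rw [llr, hx, ENNReal.toReal_ofReal (div_pos (h.pos x) (hg.pos x)).le]
  have hlogc : Continuous fun y => Real.log (p y / φ y) :=
    hpc.log fun x => (div_pos (h.pos x) (hg.pos x)).ne'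
  -- the relative entropy, transported to the Gaussian side
  have hint : Integrable (fun x => Real.log (p (T x) / φ (T x))) (gaussianReal 0 1) := by
    have h1 := hllr.congr hlog
    rw [← h.map_gaussTransport] at h1
    exact (integrable_map_measure hlogc.aestronglyMeasurable
      (measurable_gaussTransport μ).aemeasurable).1 h1
  have hent : klDiv μ (gaussianReal 0 1)
      = ENNReal.ofReal (∫ x, Real.log (p (T x) / φ (T x)) ∂(gaussianReal 0 1)) := by
    rw [klDiv_of_ac_of_integrable hac hllr, integral_congr_ae hlog]
    conv_lhs => rw [← h.map_gaussTransport]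
    rw [integral_map (measurable_gaussTransport μ).aemeasurable hlogc.aestronglyMeasurable,
      h.map_gaussTransport]
    simp [hT]
  -- integrability of the cost
  have hsq : Integrable (fun x => (T x - x) ^ 2) (gaussianReal 0 1) := by
    have hx2 : Integrable (fun x : ℝ => x ^ 2) (gaussianReal 0 1) :=
      (memLp_id_gaussianReal 2).integrable_sq
    refine ((hx2.const_mul 8).add (integrable_const (2 * c ^ 2))).mono'
      ((hTc.sub continuous_id).pow 2).aestronglyMeasurable (ae_of_all _ fun x => ?_)
    have h1 : |T x - x| ≤ 2 * |x| + c := by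
      have := abs_sub (T x) x
      have := hc x
      linarith
    have h2 := pow_le_pow_left₀ (abs_nonneg _) h1 2
    rw [sq_abs] at h2
    simp only [Pi.add_apply, norm_pow, Real.norm_eq_abs, sq_abs]
    nlinarith [sq_nonneg (2 * |x| - c), sq_abs x]
  -- the main inequality, in integrated form
  have hmain : ∫ x, (T x - x) ^ 2 / 2 ∂(gaussianReal 0 1)
      ≤ ∫ x, Real.log (p (T x) / φ (T x)) ∂(gaussianReal 0 1) := by
    have hA := integrable_gaussianReal_iff.1 (hsq.div_const 2)
    have hB := integrable_gaussianReal_iff.1 hint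
    rw [integral_gaussianReal_eq_integral_smul one_ne_zero,
      integral_gaussianReal_eq_integral_smul one_ne_zero]
    simp only [smul_eq_mul]
    set g : ℝ → ℝ := fun x => (T x - x) * φ x with hgdef
    have hgder : ∀ x, HasDerivAt g ((φ x / p (T x) - 1) * φ x + (T x - x) * (-x * φ x)) x :=
      fun x => ((h.hasDerivAt_gaussTransport x).sub (hasDerivAt_id x)).mul
        (hasDerivAt_gaussianPDFReal x)
    have hpt : ∀ x, φ x * ((T x - x) ^ 2 / 2) ≤ φ x * Real.log (p (T x) / φ (T x))
        + ((φ x / p (T x) - 1) * φ x + (T x - x) * (-x * φ x)) := by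
      intro x
      have h1 := sq_displacement_le (h.pos (T x))
        (div_pos (hg.pos x) (h.pos (T x))) x (T x) (by
          have := (h.pos (T x)).ne'
          rw [div_mul_div_comm, mul_comm (p (T x)), mul_div_mul_right _ _ this])
      have h2 := mul_le_mul_of_nonneg_left h1 (hg.pos x).le
      refine h2.trans (le_of_eq ?_)
      ring
    have hgc : Continuous fun x => (φ x / p (T x) - 1) * φ x + (T x - x) * (-x * φ x) := by
      have h1 : Continuous fun x => φ x / p (T x) :=
        hg.cont.div (h.cont.comp hTc) fun x => (h.pos _).ne'
      have h2 : Continuous φ := hg.cont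
      fun_prop
    have hle : ∀ R : ℝ, 0 ≤ R → ∫ x in (-R)..R, φ x * ((T x - x) ^ 2 / 2)
        ≤ (∫ x in (-R)..R, φ x * Real.log (p (T x) / φ (T x))) + (g R - g (-R)) := by
      intro R hR
      rw [← intervalIntegral.integral_eq_sub_of_hasDerivAt (fun x _ => hgder x)
        (hgc.intervalIntegrable _ _), ← intervalIntegral.integral_add hB.intervalIntegrable
        (hgc.intervalIntegrable _ _)]
      exact intervalIntegral.integral_mono_on (by linarith) hA.intervalIntegrable
        (hB.intervalIntegrable.add (hgc.intervalIntegrable _ _)) fun x _ => hpt x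
    -- the exact derivative integrates to boundary terms that vanish in the limit
    have hbound : ∀ x, |g x| ≤ (2 * |x| + c) * φ |x| := by
      intro x
      have h0 : φ |x| = φ x := by simp [hφ, gaussianPDFReal]
      rw [hgdef, abs_mul, abs_of_pos (hg.pos x), h0]
      refine mul_le_mul_of_nonneg_right ?_ (hg.pos x).le
      have := abs_sub (T x) x
      have := hc x
      linarith
    have hlim : Tendsto (fun R : ℝ => g R - g (-R)) atTop (𝓝 0) := by
      have h1 := (tendsto_linear_mul_gaussianPDFReal c).const_mul 2
      rw [mul_zero] at h1
      refine squeeze_zero_norm' ?_ h1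
      filter_upwards [eventually_ge_atTop 0] with R hR
      have h2 := hbound R
      have h3 := hbound (-R)
      rw [abs_neg] at h3
      rw [abs_of_nonneg hR] at h2 h3
      rw [Real.norm_eq_abs]
      have := abs_sub (g R) (g (-R))
      linarith
    have hlA := intervalIntegral_tendsto_integral hA tendsto_neg_atTop_atBot tendsto_id
    have hlB := intervalIntegral_tendsto_integral hB tendsto_neg_atTop_atBot tendsto_id
    refine (le_of_tendsto_of_tendsto hlA (hlB.add hlim) ?_).trans (le_of_eq (add_zero _))
    filter_upwards [eventually_ge_atTop 0] with R hR using hle R hR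
  rw [hent, ← ofReal_integral_eq_lintegral_ofReal hsq (ae_of_all _ fun x => sq_nonneg _),
    show (2 : ℝ≥0∞) = ENNReal.ofReal 2 by simp, ← ENNReal.ofReal_mul zero_le_two]
  refine ENNReal.ofReal_le_ofReal ?_
  rw [integral_div] at hmain
  linarith

/-! ### Tensorization of transport inequalities; Gaussian mixtures on the line -/

/-- The conditional relative entropy, integrated, is at most the relative entropy of the
composition-products. -/
theorem lintegral_klDiv_le_klDiv_compProd {α β : Type*} [MeasurableSpace α] [MeasurableSpace β]
    [MeasurableSpace.CountableOrCountablyGenerated α β] (μ : Measure α) [IsFiniteMeasure μ]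
    (κ η : Kernel α β) [IsMarkovKernel κ] [IsMarkovKernel η] :
    ∫⁻ x, klDiv (κ x) (η x) ∂μ ≤ klDiv (μ ⊗ₘ κ) (μ ⊗ₘ η) := by
  by_cases hac : μ ⊗ₘ κ ≪ μ ⊗ₘ η
  swap
  · rw [klDiv_of_not_ac hac]; exact le_top
  have hκ : ∀ᵐ x ∂μ, κ x ≪ η x := hac.kernel_of_compProd
  set f := fun p : α × β => κ.rnDeriv η p.1 p.2 with hf
  have hfm : Measurable f := Kernel.measurable_rnDeriv κ η
  have hd : μ ⊗ₘ κ = (μ ⊗ₘ η).withDensity f := by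
    rw [← Measure.compProd_withDensity (f := κ.rnDeriv η) hfm]
    refine Measure.compProd_congr ?_
    filter_upwards [hκ] with x hx using (Kernel.withDensity_rnDeriv_eq hx).symm
  have hrn : (μ ⊗ₘ κ).rnDeriv (μ ⊗ₘ η) =ᵐ[μ ⊗ₘ η] f := by
    conv_lhs => rw [hd]
    exact Measure.rnDeriv_withDensity _ hfm
  rw [klDiv_eq_lintegral_klFun_of_ac hac,
    lintegral_congr_ae (g := fun p => ENNReal.ofReal (klFun (f p).toReal))
      (by filter_upwards [hrn] with p hp; rw [hp]),
    Measure.lintegral_compProd (f := fun p => ENNReal.ofReal (klFun (f p).toReal))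
      (measurable_klFun.comp hfm.ennreal_toReal).ennreal_ofReal]
  refine le_of_eq (lintegral_congr_ae ?_)
  filter_upwards [hκ] with x hx
  rw [klDiv_eq_lintegral_klFun_of_ac hx]
  refine lintegral_congr_ae ?_
  filter_upwards [Kernel.rnDeriv_eq_rnDeriv_measure (κ := κ) (η := η) (a := x)] with y hy
  rw [← hy]

section Mixture

variable {ρ : Measure ℝ} [IsProbabilityMeasure ρ] {w : NNReal} {b : ℝ}

theorem hasPosDensity_conv_gaussianReal (ρ : Measure ℝ) [IsProbabilityMeasure ρ] (hw : w ≠ 0) :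
    HasPosDensity (ρ ∗ gaussianReal 0 w) fun y => ∫ v, gaussianPDFReal 0 w (y - v) ∂ρ := by
  have hg := hasPosDensity_gaussianReal 0 hw
  have hgc := hg.cont
  have hle : ∀ x, ‖gaussianPDFReal 0 w x‖ ≤ (√(2 * Real.pi * w))⁻¹ := by
    intro x
    rw [Real.norm_of_nonneg (hg.pos x).le, gaussianPDFReal]
    refine mul_le_of_le_one_right (by positivity) (Real.exp_le_one_iff.2 ?_)
    exact div_nonpos_of_nonpos_of_nonneg (neg_nonpos.2 (sq_nonneg _)) (by positivity)
  have hint : ∀ y, Integrable (fun v => gaussianPDFReal 0 w (y - v)) ρ := fun y =>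
    (integrable_const _).mono' (by fun_prop) (ae_of_all _ fun v => hle (y - v))
  refine ⟨?_, fun y => ?_, ?_⟩
  · exact continuous_of_dominated (fun y => (hint y).1) (fun y => ae_of_all _ fun v => hle (y - v))
      (integrable_const _) (ae_of_all _ fun v => by fun_prop)
  · refine (integral_pos_iff_support_of_nonneg (fun v => (hg.pos _).le) (hint y)).2 ?_
    have : Function.support (fun v => gaussianPDFReal 0 w (y - v)) = univ :=
      eq_univ_of_forall fun v => (hg.pos _).ne'
    rw [this]; simp
  · refine Measure.ext_of_lintegral _ fun f hf => ?_
    have hm : Measurable fun y => ENNReal.ofReal (∫ v, gaussianPDFReal 0 w (y - v) ∂ρ) := by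
      refine Measurable.ennreal_ofReal (Continuous.measurable ?_)
      exact continuous_of_dominated (fun y => (hint y).1)
        (fun y => ae_of_all _ fun v => hle (y - v))
        (integrable_const _) (ae_of_all _ fun v => by fun_prop)
    have hgm : Measurable (gaussianPDFReal 0 w) := hgc.measurable
    rw [Measure.lintegral_conv hf, lintegral_withDensity_eq_lintegral_mul _ hm hf]
    have hswap : Measurable fun q : ℝ × ℝ =>
        ENNReal.ofReal (gaussianPDFReal 0 w (q.2 - q.1)) * f q.2 := by fun_prop
    calc ∫⁻ v, ∫⁻ y, f (v + y) ∂(gaussianReal 0 w) ∂ρ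
        = ∫⁻ v, ∫⁻ y, ENNReal.ofReal (gaussianPDFReal 0 w (y - v)) * f y ∂volume ∂ρ := by
          refine lintegral_congr fun v => ?_
          rw [hg.eq, lintegral_withDensity_eq_lintegral_mul _ hgm.ennreal_ofReal (by fun_prop)]
          conv_rhs => rw [← lintegral_add_left_eq_self _ v]
          simp
      _ = ∫⁻ y, ∫⁻ v, ENNReal.ofReal (gaussianPDFReal 0 w (y - v)) * f y ∂ρ :=
          lintegral_lintegral_swap hswap.aemeasurable
      _ = _ := by
          refine lintegral_congr fun y => ?_
          rw [lintegral_mul_const _ (by fun_prop), Pi.mul_apply,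
            ofReal_integral_eq_lintegral_ofReal (hint y) (ae_of_all _ fun v => (hg.pos _).le)]

theorem cdf_conv_le_cdf (hb : ∀ᵐ v ∂ρ, |v| ≤ b) (t : ℝ) :
    cdf (ρ ∗ gaussianReal 0 w) t ≤ cdf (gaussianReal 0 w) (t + b) ∧
      cdf (gaussianReal 0 w) (t - b) ≤ cdf (ρ ∗ gaussianReal 0 w) t := by
  have hF : (ρ ∗ gaussianReal 0 w) (Iic t) = ∫⁻ v, gaussianReal 0 w (Iic (t - v)) ∂ρ := by
    rw [← lintegral_indicator_one measurableSet_Iic,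
      Measure.lintegral_conv (measurable_one.indicator measurableSet_Iic)]
    refine lintegral_congr fun v => ?_
    rw [← lintegral_indicator_one measurableSet_Iic]
    refine lintegral_congr fun y => ?_
    have : v + y ∈ Iic t ↔ y ∈ Iic (t - v) := by simp [le_sub_iff_add_le']
    simp only [indicator, this, Pi.one_apply]
  rw [cdf_eq_real, cdf_eq_real, cdf_eq_real, measureReal_def, measureReal_def, measureReal_def]
  constructor
  · refine ENNReal.toReal_mono (measure_ne_top _ _) ?_
    rw [hF]
    calc _ ≤ ∫⁻ _, gaussianReal 0 w (Iic (t + b)) ∂ρ := lintegral_mono_ae (by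
            filter_upwards [hb] with v hv
            exact measure_mono (Iic_subset_Iic.2 (by linarith [neg_le_of_abs_le hv])))
      _ = _ := by simp
  · refine ENNReal.toReal_mono (measure_ne_top _ _) ?_
    rw [hF]
    calc _ = ∫⁻ _, gaussianReal 0 w (Iic (t - b)) ∂ρ := by simp
      _ ≤ _ := lintegral_mono_ae (by
            filter_upwards [hb] with v hv
            exact measure_mono (Iic_subset_Iic.2 (by linarith [le_of_abs_le hv])))

theorem cdf_gaussianReal_sqrt_mul (hw : w ≠ 0) (x : ℝ) :
    cdf (gaussianReal 0 w) (√w * x) = cdf (gaussianReal 0 1) x := by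
  have hmap : (gaussianReal 0 1).map (fun x => √w * x) = gaussianReal 0 w := by
    rw [gaussianReal_map_const_mul]
    congr 1
    · simp
    · ext; simp
  have hpos : 0 < √(w : ℝ) := Real.sqrt_pos.2 (by positivity)
  rw [cdf_eq_real, cdf_eq_real, measureReal_def, measureReal_def, ← hmap,
    Measure.map_apply (by fun_prop) measurableSet_Iic]
  congr 2
  ext y
  simp only [mem_preimage, mem_Iic]
  exact mul_le_mul_iff_right₀ hpos

/-- The monotone map to a bounded Gaussian mixture grows at most linearly: the distribution function
of the mixture lies between two translates of a Gaussian one. -/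
theorem abs_gaussTransport_conv_le (hw : w ≠ 0) (hw1 : w ≤ 1) (hb : ∀ᵐ v ∂ρ, |v| ≤ b) (x : ℝ) :
    |gaussTransport (ρ ∗ gaussianReal 0 w) x| ≤ |x| + b := by
  set T := gaussTransport (ρ ∗ gaussianReal 0 w) x with hT
  have hs : |√(w : ℝ) * x| ≤ |x| := by
    rw [abs_mul, abs_of_nonneg (Real.sqrt_nonneg _)]
    exact mul_le_of_le_one_left (abs_nonneg _) (Real.sqrt_le_one.2 (by exact_mod_cast hw1))
  have h1 : T ≤ √w * x + b := by
    rw [hT, gaussTransport_le_iff, ← cdf_gaussianReal_sqrt_mul hw]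
    simpa using (cdf_conv_le_cdf hb (√w * x + b)).2
  have h2 : √w * x ≤ T + b := by
    have h3 := (gaussTransport_le_iff (ρ ∗ gaussianReal 0 w) x T).1 le_rfl
    rw [← cdf_gaussianReal_sqrt_mul hw] at h3
    exact (hasPosDensity_gaussianReal 0 hw).strictMono_cdf.le_iff_le.1
      (h3.trans (cdf_conv_le_cdf hb T).1)
  rw [abs_le] at hs ⊢
  constructor <;> linarith

/-- Talagrand's inequality on the line for bounded translates of a Gaussian measure. -/
theorem lintegral_sq_gaussTransport_conv_le (hw : w ≠ 0) (hw1 : w ≤ 1) (hb : ∀ᵐ v ∂ρ, |v| ≤ b) :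
    ∫⁻ x, ENNReal.ofReal ((gaussTransport (ρ ∗ gaussianReal 0 w) x - x) ^ 2) ∂(gaussianReal 0 1)
      ≤ 2 * klDiv (ρ ∗ gaussianReal 0 w) (gaussianReal 0 1) :=
  (hasPosDensity_conv_gaussianReal ρ hw).lintegral_sq_gaussTransport_le
    (abs_gaussTransport_conv_le hw hw1 hb)

end Mixture

/-- A Talagrand inequality for `μ` relative to `ν` extends to `μ ⊗ₘ κ` relative to the product of
`ν` and the standard Gaussian measure: the additional coordinate is coupled by the monotone maps of
the conditional laws. -/
theorem exists_coupling_compProd {E : Type*} [MeasurableSpace E] {μ ν : Measure E}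
    [IsProbabilityMeasure μ] [IsProbabilityMeasure ν] {c : E → E → ℝ≥0∞}
    (hc : Measurable (Function.uncurry c)) {π : Measure (E × E)} (hπ : IsCoupling π μ ν)
    (hcost : ∫⁻ z, c z.1 z.2 ∂π ≤ 2 * klDiv μ ν) (κ : Kernel E ℝ) [IsMarkovKernel κ]
    (hmap : ∀ x, (gaussianReal 0 1).map (gaussTransport (κ x)) = κ x)
    (hκ : ∀ᵐ x ∂μ, ∫⁻ y, ENNReal.ofReal ((gaussTransport (κ x) y - y) ^ 2) ∂(gaussianReal 0 1)
      ≤ 2 * klDiv (κ x) (gaussianReal 0 1)) :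
    ∃ π' : Measure ((E × ℝ) × (E × ℝ)),
      IsCoupling π' (μ ⊗ₘ κ) (ν.prod (gaussianReal 0 1)) ∧
      ∫⁻ z, (c z.1.1 z.2.1 + ENNReal.ofReal ((z.1.2 - z.2.2) ^ 2)) ∂π'
        ≤ 2 * klDiv (μ ⊗ₘ κ) (ν.prod (gaussianReal 0 1)) := by
  have : IsProbabilityMeasure π :=
    ⟨by rw [← Measure.fst_univ, hπ.1]; exact measure_univ⟩
  have hT := measurable_gaussTransport_uncurry κ
  set F : (E × E) × ℝ → (E × ℝ) × (E × ℝ) :=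
    fun q => ((q.1.1, gaussTransport (κ q.1.1) q.2), (q.1.2, q.2)) with hF
  have hTm : Measurable fun q : (E × E) × ℝ => gaussTransport (κ q.1.1) q.2 :=
    hT.comp (by fun_prop : Measurable fun q : (E × E) × ℝ => (q.1.1, q.2))
  have hFm : Measurable F := by
    refine Measurable.prodMk (Measurable.prodMk (by fun_prop) hTm) (by fun_prop)
  have hfstm : ∀ f : E → ℝ≥0∞, Measurable f → ∫⁻ z, f z.1 ∂π = ∫⁻ x, f x ∂μ := fun f hf => by
    rw [← hπ.1, Measure.fst, lintegral_map hf measurable_fst]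
  refine ⟨(π.prod (gaussianReal 0 1)).map F, ⟨?_, ?_⟩, ?_⟩
  · refine Measure.ext_of_lintegral _ fun f hf => ?_
    have hf2 : Measurable fun q : E × ℝ => f (q.1, gaussTransport (κ q.1) q.2) :=
      hf.comp (measurable_fst.prodMk hT)
    have hf1 : Measurable fun q : (E × E) × ℝ => f (q.1.1, gaussTransport (κ q.1.1) q.2) :=
      hf2.comp (by fun_prop : Measurable fun q : (E × E) × ℝ => (q.1.1, q.2))
    rw [Measure.fst, lintegral_map hf measurable_fst, lintegral_map (by fun_prop) hFm,
      lintegral_prod _ hf1.aemeasurable,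
      hfstm (fun x => ∫⁻ y, f (x, gaussTransport (κ x) y) ∂(gaussianReal 0 1))
        hf2.lintegral_prod_right', Measure.lintegral_compProd hf]
    refine lintegral_congr fun x => ?_
    conv_rhs => rw [← hmap x]
    rw [lintegral_map (by fun_prop) (measurable_gaussTransport _)]
  · have : (Prod.snd ∘ F) = Prod.map Prod.snd id := rfl
    rw [Measure.snd, Measure.map_map measurable_snd hFm, this,
      ← Measure.map_prod_map _ _ measurable_snd measurable_id, Measure.map_id]
    rw [← hπ.2]; rfl
  · have hcm : Measurable fun z : (E × ℝ) × (E × ℝ) => c z.1.1 z.2.1 :=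
      hc.comp (by fun_prop : Measurable fun z : (E × ℝ) × (E × ℝ) => (z.1.1, z.2.1))
    have hq : Measurable fun q : E × ℝ =>
        ENNReal.ofReal ((gaussTransport (κ q.1) q.2 - q.2) ^ 2) :=
      ((hT.sub measurable_snd).pow_const 2).ennreal_ofReal
    have hq' : Measurable fun q : (E × E) × ℝ =>
        ENNReal.ofReal ((gaussTransport (κ q.1.1) q.2 - q.2) ^ 2) :=
      ((hTm.sub measurable_snd).pow_const 2).ennreal_ofReal
    have hsq : Measurable fun z : (E × ℝ) × (E × ℝ) => ENNReal.ofReal ((z.1.2 - z.2.2) ^ 2) := by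
      fun_prop
    have h1 : ∫⁻ z, c z.1.1 z.2.1 ∂((π.prod (gaussianReal 0 1)).map F) ≤ 2 * klDiv μ ν := by
      rw [lintegral_map hcm hFm, lintegral_prod (fun q => c (F q).1.1 (F q).2.1)
        (hcm.comp hFm).aemeasurable]
      simpa [hF] using hcost
    have h2 : ∫⁻ z, ENNReal.ofReal ((z.1.2 - z.2.2) ^ 2) ∂((π.prod (gaussianReal 0 1)).map F)
        ≤ 2 * klDiv (μ ⊗ₘ κ) (μ ⊗ₘ Kernel.const E (gaussianReal 0 1)) := by
      have h3 : ∫⁻ z, ENNReal.ofReal ((z.1.2 - z.2.2) ^ 2) ∂((π.prod (gaussianReal 0 1)).map F)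
          = ∫⁻ x, ∫⁻ y, ENNReal.ofReal ((gaussTransport (κ x) y - y) ^ 2)
              ∂(gaussianReal 0 1) ∂μ := by
        rw [lintegral_map hsq hFm, lintegral_prod _ hq'.aemeasurable]
        exact hfstm _ hq.lintegral_prod_right'
      rw [h3]
      refine (lintegral_mono_ae hκ).trans ?_
      rw [lintegral_const_mul' _ _ (by simp)]
      exact mul_le_mul_right (lintegral_klDiv_le_klDiv_compProd μ κ _) 2
    rw [lintegral_add_left hcm, ← Measure.compProd_const (μ := ν), klDiv_compProd_eq_add, mul_add]
    exact add_le_add h1 h2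

/-! ### Talagrand's inequality for Gaussian mixtures -/

/-- Separates the first coordinate of a vector from the others. -/
def splitFirst (n : ℕ) (u : Fin (n + 1) → ℝ) : (Fin n → ℝ) × ℝ := (fun i => u i.succ, u 0)

theorem measurable_splitFirst (n : ℕ) : Measurable (splitFirst n) := by
  unfold splitFirst; fun_prop

/-- The inverse of `splitFirst`. -/
def joinFirst (n : ℕ) (q : (Fin n → ℝ) × ℝ) : Fin (n + 1) → ℝ := Fin.cons q.2 q.1

theorem measurable_joinFirst (n : ℕ) : Measurable (joinFirst n) := by
  refine measurable_pi_lambda _ fun i => ?_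
  refine Fin.cases ?_ (fun j => ?_) i
  · exact measurable_snd
  · simp only [joinFirst, Fin.cons_succ]; fun_prop

theorem joinFirst_splitFirst (n : ℕ) (u : Fin (n + 1) → ℝ) : joinFirst n (splitFirst n u) = u := by
  ext i
  refine Fin.cases ?_ (fun j => ?_) i <;> simp [joinFirst, splitFirst]

theorem map_splitFirst_pi {n : ℕ} (m : Fin (n + 1) → Measure ℝ) [∀ i, SigmaFinite (m i)] :
    (Measure.pi m).map (splitFirst n) = (Measure.pi fun i : Fin n => m i.succ).prod (m 0) := by
  have h := (measurePreserving_piFinSuccAbove m 0)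
  have h2 : splitFirst n = Prod.swap ∘ MeasurableEquiv.piFinSuccAbove (fun _ => ℝ) 0 := by
    funext u; rfl
  rw [h2, ← Measure.map_map measurable_swap (MeasurableEquiv.measurable _), h.map_eq,
    Measure.prod_swap]
  rfl

/-- The law of `V + ξ`, where `V` has law `ρ` and `ξ` is an independent centred Gaussian vector
with independent coordinates of variances `w i`. -/
noncomputable def gaussMix {n : ℕ} (ρ : Measure (Fin n → ℝ)) (w : Fin n → NNReal) :
    Measure (Fin n → ℝ) :=
  ρ ∗ Measure.pi fun i => gaussianReal 0 (w i)

instance {n : ℕ} (ρ : Measure (Fin n → ℝ)) [IsProbabilityMeasure ρ] (w : Fin n → NNReal) :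
    IsProbabilityMeasure (gaussMix ρ w) := by unfold gaussMix; infer_instance

/-- Disintegration of a Gaussian mixture along the first coordinate: the conditional law of the
first coordinate is again a Gaussian mixture, its mixing measure being the posterior law of the
first coordinate of the mixing vector. -/
theorem exists_disintegration_gaussMix {n : ℕ} (ρ : Measure (Fin (n + 1) → ℝ))
    [IsProbabilityMeasure ρ] (w : Fin (n + 1) → NNReal) {b : ℝ} (hb : ∀ᵐ v ∂ρ, ∀ i, |v i| ≤ b) :
    ∃ (ρ' : Measure (Fin n → ℝ)) (κ₀ κ : Kernel (Fin n → ℝ) ℝ), IsProbabilityMeasure ρ' ∧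
      IsMarkovKernel κ₀ ∧ IsMarkovKernel κ ∧ (∀ᵐ v ∂ρ', ∀ i, |v i| ≤ b) ∧
      (∀ x, κ x = κ₀ x ∗ gaussianReal 0 (w 0)) ∧
      (∀ᵐ x ∂(gaussMix ρ' fun i => w i.succ), ∀ᵐ v ∂(κ₀ x), |v| ≤ b) ∧
      (gaussMix ρ w).map (splitFirst n) = gaussMix ρ' (fun i => w i.succ) ⊗ₘ κ := by
  set tl : (Fin (n + 1) → ℝ) → Fin n → ℝ := fun u i => u i.succ with htl
  have htlm : Measurable tl := by fun_prop
  set N := Measure.pi fun i : Fin n => gaussianReal 0 (w i.succ) with hN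
  set τ : Measure ((Fin n → ℝ) × ℝ) := (ρ.prod N).map fun q => (tl q.1 + q.2, q.1 0) with hτ
  have hτm : Measurable fun q : (Fin (n + 1) → ℝ) × (Fin n → ℝ) => (tl q.1 + q.2, q.1 0) := by
    fun_prop
  have : IsProbabilityMeasure τ := Measure.isProbabilityMeasure_map hτm.aemeasurable
  have hρ' : IsProbabilityMeasure (ρ.map tl) := Measure.isProbabilityMeasure_map htlm.aemeasurable
  set κ : Kernel (Fin n → ℝ) ℝ :=
    (τ.condKernel ×ₖ Kernel.const _ (gaussianReal 0 (w 0))).map (fun q => q.1 + q.2) with hκ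
  have hκM : IsMarkovKernel κ := Kernel.IsMarkovKernel.map _ (by fun_prop)
  have hκx : ∀ x, κ x = τ.condKernel x ∗ gaussianReal 0 (w 0) := by
    intro x
    rw [hκ, Kernel.map_apply _ (by fun_prop), Kernel.prod_apply, Kernel.const_apply]
    rfl
  have hτfst : τ.fst = gaussMix (ρ.map tl) fun i => w i.succ := by
    rw [Measure.fst, hτ, Measure.map_map measurable_fst hτm, gaussMix, Measure.conv]
    have h1 : (ρ.map tl).prod N = (ρ.prod N).map (Prod.map tl id) := by
      rw [← Measure.map_prod_map _ _ htlm measurable_id, Measure.map_id]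
    rw [← hN, h1, Measure.map_map (by fun_prop) (by fun_prop)]
    rfl
  -- `τ` is the joint law of the remaining coordinates of the mixture and of the first coordinate
  -- of the mixing vector, so its conditional kernel is the posterior law of the latter
  refine ⟨ρ.map tl, τ.condKernel, κ, hρ', inferInstance, hκM, ?_, hκx, ?_, ?_⟩
  · have hms : MeasurableSet {v : Fin n → ℝ | ∀ i, |v i| ≤ b} := by
      simp only [ofPred_forall]
      exact MeasurableSet.iInter fun i => measurableSet_le (by fun_prop) measurable_const
    rw [ae_map_iff htlm.aemeasurable hms]
    filter_upwards [hb] with v hv i using hv i.succ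
  · rw [← hτfst]
    refine Measure.ae_ae_of_ae_compProd (p := fun q => |q.2| ≤ b) ?_
    rw [Measure.disintegrate, hτ, ae_map_iff hτm.aemeasurable
      (measurableSet_le (by fun_prop) measurable_const)]
    have h1 : ∀ᵐ q ∂(ρ.prod N), ∀ i, |q.1 i| ≤ b :=
      (Measure.quasiMeasurePreserving_fst (μ := ρ) (ν := N)).ae hb
    filter_upwards [h1] with q hq using hq 0
  · rw [← hτfst]
    refine Measure.ext_of_lintegral _ fun f hf => ?_
    have hsp := measurable_splitFirst n
    have hLHS : ∫⁻ z, f z ∂((gaussMix ρ w).map (splitFirst n))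
        = ∫⁻ v, ∫⁻ x, ∫⁻ y, f (tl v + x, v 0 + y) ∂(gaussianReal 0 (w 0)) ∂N ∂ρ := by
      rw [lintegral_map hf hsp, gaussMix, Measure.lintegral_conv (by fun_prop)]
      refine lintegral_congr fun v => ?_
      have h1 : ∀ u, f (splitFirst n (v + u))
          = (fun q : (Fin n → ℝ) × ℝ => f (tl v + q.1, v 0 + q.2)) (splitFirst n u) :=
        fun u => rfl
      have h2 : Measurable fun q : (Fin n → ℝ) × ℝ => f (tl v + q.1, v 0 + q.2) := by fun_prop
      rw [lintegral_congr h1, ← lintegral_map h2 hsp, map_splitFirst_pi,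
        lintegral_prod _ h2.aemeasurable]
    have hg : Measurable fun r : (Fin n → ℝ) × ℝ =>
        ∫⁻ y, f (r.1, r.2 + y) ∂(gaussianReal 0 (w 0)) :=
      Measurable.lintegral_prod_right' (f := fun q : ((Fin n → ℝ) × ℝ) × ℝ =>
        f (q.1.1, q.1.2 + q.2)) (by fun_prop)
    have hRHS : ∫⁻ z, f z ∂(τ.fst ⊗ₘ κ)
        = ∫⁻ r, ∫⁻ y, f (r.1, r.2 + y) ∂(gaussianReal 0 (w 0)) ∂τ := by
      rw [Measure.lintegral_compProd hf]
      conv_rhs => rw [← τ.disintegrate τ.condKernel]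
      rw [Measure.lintegral_compProd hg]
      refine lintegral_congr fun x => ?_
      rw [hκx, Measure.lintegral_conv (by fun_prop)]
    rw [hLHS, hRHS, hτ, lintegral_map hg hτm]
    exact (lintegral_prod _ (hg.comp hτm).aemeasurable).symm

/-- Talagrand's transport inequality, with the standard Gaussian measure on `ℝⁿ` as reference
measure, for bounded mixtures of translates of a centred Gaussian measure with independent
coordinates. -/
theorem exists_coupling_gaussMix_le_klDiv {b : ℝ} : ∀ {n : ℕ} (ρ : Measure (Fin n → ℝ))
    [IsProbabilityMeasure ρ] (w : Fin n → NNReal), (∀ i, w i ≠ 0) → (∀ i, w i ≤ 1) →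
    (∀ᵐ v ∂ρ, ∀ i, |v i| ≤ b) →
    ∃ π : Measure ((Fin n → ℝ) × (Fin n → ℝ)),
      IsCoupling π (gaussMix ρ w) (Measure.pi fun _ => gaussianReal 0 1) ∧
      ∫⁻ z, ∑ i, ENNReal.ofReal ((z.1 i - z.2 i) ^ 2) ∂π
        ≤ 2 * klDiv (gaussMix ρ w) (Measure.pi fun _ => gaussianReal 0 1) := by
  intro n
  induction n with
  | zero =>
    intro ρ _ w _ _ _
    refine ⟨(gaussMix ρ w).prod (Measure.pi fun _ => gaussianReal 0 1), ⟨?_, ?_⟩, ?_⟩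
    · simp [Measure.fst_prod]
    · simp [Measure.snd_prod]
    · simp
  | succ n ih =>
    intro ρ _ w hw hw1 hb
    obtain ⟨ρ', κ₀, κ, _, _, _, hb', hκx, hκb, hdis⟩ := exists_disintegration_gaussMix ρ w hb
    obtain ⟨π, hπ, hcost⟩ := ih ρ' (fun i => w i.succ) (fun i => hw _) (fun i => hw1 _) hb'
    have hcm : Measurable (Function.uncurry fun x y : Fin n → ℝ =>
        ∑ i, ENNReal.ofReal ((x i - y i) ^ 2)) := by
      simp only [Function.uncurry_def]; fun_prop
    obtain ⟨π', ⟨hπ1, hπ2⟩, hcost'⟩ := exists_coupling_compProd hcm hπ hcost κ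
      (fun x => by
        rw [hκx]
        exact (hasPosDensity_conv_gaussianReal (κ₀ x) (hw 0)).map_gaussTransport)
      (by
        filter_upwards [hκb] with x hx
        rw [hκx]
        exact lintegral_sq_gaussTransport_conv_le (hw 0) (hw1 0) hx)
    rw [← map_splitFirst_pi (fun _ : Fin (n + 1) => gaussianReal 0 1)] at hπ2 hcost'
    rw [← hdis] at hπ1 hcost'
    have hj := measurable_joinFirst n
    have hs := measurable_splitFirst n
    have hjs : joinFirst n ∘ splitFirst n = id := funext (joinFirst_splitFirst n)
    refine ⟨π'.map (Prod.map (joinFirst n) (joinFirst n)), ⟨?_, ?_⟩, ?_⟩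
    · have h1 : Prod.fst ∘ Prod.map (joinFirst n) (joinFirst n) = joinFirst n ∘ Prod.fst := rfl
      rw [Measure.fst, Measure.map_map measurable_fst (by fun_prop), h1,
        ← Measure.map_map hj measurable_fst]
      change (π'.fst).map _ = _
      rw [hπ1, Measure.map_map hj hs, hjs, Measure.map_id]
    · have h1 : Prod.snd ∘ Prod.map (joinFirst n) (joinFirst n) = joinFirst n ∘ Prod.snd := rfl
      rw [Measure.snd, Measure.map_map measurable_snd (by fun_prop), h1,
        ← Measure.map_map hj measurable_snd]
      change (π'.snd).map _ = _
      rw [hπ2, Measure.map_map hj hs, hjs, Measure.map_id]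
    · rw [lintegral_map (by fun_prop) (by fun_prop)]
      refine (le_of_eq ?_).trans (hcost'.trans ?_)
      · refine lintegral_congr fun z => ?_
        simp [Fin.sum_univ_succ, joinFirst, add_comm]
      · exact mul_le_mul_right (klDiv_map_le _ _ hs) 2

/-! ### Couplings with bounded quadratic cost -/

/-- `μ` and `ν` have a coupling of quadratic transport cost at most `c ^ 2`. -/
def CoupledWithin {E : Type*} [PseudoEMetricSpace E] [MeasurableSpace E] (c : ℝ≥0∞)
    (μ ν : Measure E) : Prop :=
  ∃ π : Measure (E × E), IsCoupling π μ ν ∧ ∫⁻ z, edist z.1 z.2 ^ (2 : ℝ) ∂π ≤ c ^ (2 : ℝ)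

namespace CoupledWithin

theorem wassersteinDist_le {E : Type*} [PseudoEMetricSpace E] [MeasurableSpace E] {c : ℝ≥0∞}
    {μ ν : Measure E} (h : CoupledWithin c μ ν) : wassersteinDist 2 μ ν ≤ c := by
  obtain ⟨π, hπ, hc⟩ := h
  calc wassersteinDist 2 μ ν ≤ (c ^ (2 : ℝ)) ^ (1 / (2 : ℝ)) :=
        ENNReal.rpow_le_rpow ((iInf₂_le π hπ).trans hc) (by norm_num)
    _ = c := by rw [← ENNReal.rpow_mul]; norm_num

theorem isProbabilityMeasure_of_isCoupling {E : Type*} [MeasurableSpace E] {π : Measure (E × E)}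
    {μ ν : Measure E} [IsProbabilityMeasure μ] (h : IsCoupling π μ ν) : IsProbabilityMeasure π :=
  ⟨by rw [← Measure.fst_univ, h.1]; exact measure_univ⟩

theorem measurable_edist_rpow {E : Type*} [NormedAddCommGroup E] [MeasurableSpace E] [BorelSpace E]
    [SecondCountableTopology E] : Measurable fun z : E × E => edist z.1 z.2 ^ (2 : ℝ) := by
  fun_prop

theorem map {E F : Type*} [PseudoEMetricSpace E] [MeasurableSpace E]
    [NormedAddCommGroup F] [MeasurableSpace F] [BorelSpace F]
    [SecondCountableTopology F] {c : ℝ≥0∞} {μ ν : Measure E} (h : CoupledWithin c μ ν) {f : E → F}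
    (hf : Measurable f) (hlip : ∀ x y, edist (f x) (f y) ≤ edist x y) :
    CoupledWithin c (μ.map f) (ν.map f) := by
  obtain ⟨π, hπ, hc⟩ := h
  have hff : Measurable (Prod.map f f) := by fun_prop
  refine ⟨π.map (Prod.map f f), ⟨?_, ?_⟩, ?_⟩
  · rw [← hπ.1, Measure.fst, Measure.fst, Measure.map_map measurable_fst hff,
      Measure.map_map hf measurable_fst]
    rfl
  · rw [← hπ.2, Measure.snd, Measure.snd, Measure.map_map measurable_snd hff,
      Measure.map_map hf measurable_snd]
    rfl
  · rw [lintegral_map measurable_edist_rpow hff]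
    exact (lintegral_mono fun z => ENNReal.rpow_le_rpow (hlip _ _) two_pos.le).trans hc

variable {E : Type*} [NormedAddCommGroup E] [MeasurableSpace E] [BorelSpace E]
  [SecondCountableTopology E]

theorem refl (c : ℝ≥0∞) (μ : Measure E) : CoupledWithin c μ μ := by
  refine ⟨μ.map fun x => (x, x), ⟨?_, ?_⟩, ?_⟩
  · rw [Measure.fst, Measure.map_map measurable_fst (by fun_prop)]; exact Measure.map_id
  · rw [Measure.snd, Measure.map_map measurable_snd (by fun_prop)]; exact Measure.map_id
  · rw [lintegral_map measurable_edist_rpow (by fun_prop)]; simp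

theorem conv {c : ℝ≥0∞} {μ ν : Measure E} [IsProbabilityMeasure μ] (h : CoupledWithin c μ ν)
    (ρ : Measure E) [IsProbabilityMeasure ρ] : CoupledWithin c (μ ∗ ρ) (ν ∗ ρ) := by
  obtain ⟨π, hπ, hc⟩ := h
  have := isProbabilityMeasure_of_isCoupling hπ
  set F : (E × E) × E → E × E := fun q => (q.1.1 + q.2, q.1.2 + q.2) with hF
  have hFm : Measurable F := by fun_prop
  refine ⟨(π.prod ρ).map F, ⟨?_, ?_⟩, ?_⟩
  · have h1 : Prod.fst ∘ F = (fun q : E × E => q.1 + q.2) ∘ Prod.map Prod.fst id := rfl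
    rw [Measure.fst, Measure.map_map measurable_fst hFm, h1,
      ← Measure.map_map (by fun_prop) (by fun_prop),
      ← Measure.map_prod_map _ _ measurable_fst measurable_id, Measure.map_id]
    change (π.fst.prod ρ).map _ = _
    rw [hπ.1]; rfl
  · have h1 : Prod.snd ∘ F = (fun q : E × E => q.1 + q.2) ∘ Prod.map Prod.snd id := rfl
    rw [Measure.snd, Measure.map_map measurable_snd hFm, h1,
      ← Measure.map_map (by fun_prop) (by fun_prop),
      ← Measure.map_prod_map _ _ measurable_snd measurable_id, Measure.map_id]
    change (π.snd.prod ρ).map _ = _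
    rw [hπ.2]; rfl
  · rw [lintegral_map measurable_edist_rpow hFm,
      lintegral_prod (fun q => edist (F q).1 (F q).2 ^ (2 : ℝ))
        (measurable_edist_rpow.comp hFm).aemeasurable]
    simpa [hF] using hc

/-- The triangle inequality, by gluing two couplings along their common marginal. -/
theorem trans [StandardBorelSpace E] {c₁ c₂ : ℝ≥0∞} {μ₁ μ₂ μ₃ : Measure E}
    [IsProbabilityMeasure μ₁] [IsProbabilityMeasure μ₂] (h₁ : CoupledWithin c₁ μ₁ μ₂)
    (h₂ : CoupledWithin c₂ μ₂ μ₃) : CoupledWithin (c₁ + c₂) μ₁ μ₃ := by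
  obtain ⟨π₁, hπ₁, hc₁⟩ := h₁
  obtain ⟨π₂, hπ₂, hc₂⟩ := h₂
  have := isProbabilityMeasure_of_isCoupling hπ₁
  have := isProbabilityMeasure_of_isCoupling hπ₂
  set τ := π₁.map Prod.swap with hτ
  have : IsProbabilityMeasure τ := Measure.isProbabilityMeasure_map measurable_swap.aemeasurable
  have hτ1 : τ.fst = μ₂ := by rw [hτ, Measure.fst_map_swap, hπ₁.2]
  -- the middle variable comes first; the outer ones are conditionally independent given it
  set Q : Measure (E × (E × E)) := μ₂ ⊗ₘ (τ.condKernel ×ₖ π₂.condKernel) with hQ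
  have hQ1 : Q.map (fun q => (q.2.1, q.1)) = π₁ := by
    have h1 : Q.map (fun q => (q.1, q.2.1)) = τ := by
      refine Measure.ext_of_lintegral _ fun f hf => ?_
      rw [lintegral_map hf (by fun_prop), hQ, Measure.lintegral_compProd (by fun_prop)]
      conv_rhs => rw [← τ.disintegrate τ.condKernel]
      rw [Measure.lintegral_compProd hf, hτ1]
      refine lintegral_congr fun x => ?_
      rw [Kernel.prod_apply, lintegral_prod _ (by fun_prop)]
      simp
    have h2 : (fun q : E × (E × E) => (q.2.1, q.1)) = Prod.swap ∘ fun q => (q.1, q.2.1) := rfl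
    rw [h2, ← Measure.map_map measurable_swap (by fun_prop), h1, hτ,
      Measure.map_map measurable_swap measurable_swap]
    simp
  have hQ2 : Q.map (fun q => (q.1, q.2.2)) = π₂ := by
    refine Measure.ext_of_lintegral _ fun f hf => ?_
    rw [lintegral_map hf (by fun_prop), hQ, Measure.lintegral_compProd (by fun_prop)]
    conv_rhs => rw [← π₂.disintegrate π₂.condKernel]
    rw [Measure.lintegral_compProd hf, hπ₂.1]
    refine lintegral_congr fun x => ?_
    rw [Kernel.prod_apply, lintegral_prod _ (by fun_prop)]
    simp
  refine ⟨Q.map (fun q => (q.2.1, q.2.2)), ⟨?_, ?_⟩, ?_⟩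
  · rw [← hπ₁.1, ← hQ1, Measure.fst, Measure.fst, Measure.map_map measurable_fst (by fun_prop),
      Measure.map_map measurable_fst (by fun_prop)]
    rfl
  · rw [← hπ₂.2, ← hQ2, Measure.snd, Measure.snd, Measure.map_map measurable_snd (by fun_prop),
      Measure.map_map measurable_snd (by fun_prop)]
    rfl
  · rw [← hQ1, lintegral_map measurable_edist_rpow (by fun_prop)] at hc₁
    rw [← hQ2, lintegral_map measurable_edist_rpow (by fun_prop)] at hc₂
    rw [lintegral_map measurable_edist_rpow (by fun_prop)]
    have hroot : ∀ {c I : ℝ≥0∞}, I ≤ c ^ (2 : ℝ) → I ^ (1 / (2 : ℝ)) ≤ c := fun {c I} h => by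
      calc I ^ (1 / (2 : ℝ)) ≤ (c ^ (2 : ℝ)) ^ (1 / (2 : ℝ)) :=
            ENNReal.rpow_le_rpow h (by norm_num)
        _ = c := by rw [← ENNReal.rpow_mul]; norm_num
    have hmink := ENNReal.lintegral_Lp_add_le (μ := Q) (p := 2)
      (f := fun q : E × (E × E) => edist q.2.1 q.1) (g := fun q => edist q.1 q.2.2)
      (by fun_prop) (by fun_prop) one_le_two
    have h3 := hmink.trans (add_le_add (hroot hc₁) (hroot hc₂))
    have h4 := ENNReal.rpow_le_rpow h3 (zero_le_two (α := ℝ))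
    rw [← ENNReal.rpow_mul] at h4
    norm_num at h4
    refine le_trans (lintegral_mono fun q => ?_) (by simpa using h4)
    have := edist_triangle q.2.1 q.1 q.2.2
    simpa using ENNReal.rpow_le_rpow this (zero_le_two (α := ℝ))

end CoupledWithin

/-! ### Relative entropy of Gaussian mixtures and the Mehler kernel -/

theorem lintegral_pi_prod {n : ℕ} {X : Type*} [MeasurableSpace X] (m : Fin n → Measure X)
    [∀ i, IsProbabilityMeasure (m i)] {f : Fin n → X → ℝ≥0∞} (hf : ∀ i, Measurable (f i)) :
    ∫⁻ x, ∏ i, f i (x i) ∂(Measure.pi m) = ∏ i, ∫⁻ x, f i x ∂(m i) := by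
  have h := lintegral_prod_eq_prod_lintegral_of_indepFun (μ := Measure.pi m) Finset.univ
    (fun i x => f i (x i)) (iIndepFun_pi fun i => (hf i).aemeasurable)
    (fun i => (hf i).comp (measurable_pi_apply i))
  rw [h]
  refine Finset.prod_congr rfl fun i _ => ?_
  exact (measurePreserving_eval m i).lintegral_comp (hf i)

theorem pi_withDensity {n : ℕ} {X : Type*} [MeasurableSpace X] (m : Fin n → Measure X)
    [∀ i, IsProbabilityMeasure (m i)] {f : Fin n → X → ℝ≥0∞} (hf : ∀ i, Measurable (f i))
    [∀ i, SigmaFinite ((m i).withDensity (f i))] :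
    (Measure.pi fun i => (m i).withDensity (f i))
      = (Measure.pi m).withDensity fun x => ∏ i, f i (x i) := by
  classical
  refine Measure.pi_eq fun s hs => ?_
  rw [withDensity_apply _ (MeasurableSet.univ_pi hs),
    ← lintegral_indicator (MeasurableSet.univ_pi hs)]
  have h1 : ∀ x : Fin n → X, (univ.pi s).indicator (fun x => ∏ i, f i (x i)) x
      = ∏ i, (s i).indicator (f i) (x i) := by
    intro x
    by_cases hx : x ∈ univ.pi s
    · rw [indicator_of_mem hx]
      exact Finset.prod_congr rfl fun i _ => (indicator_of_mem (hx i (mem_univ i)) _).symm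
    · rw [indicator_of_notMem hx]
      simp only [Set.mem_pi, mem_univ, true_implies, not_forall] at hx
      obtain ⟨i, hi⟩ := hx
      exact (Finset.prod_eq_zero (Finset.mem_univ i) (indicator_of_notMem hi _)).symm
  rw [lintegral_congr h1, lintegral_pi_prod m fun i => (hf i).indicator (hs i)]
  refine Finset.prod_congr rfl fun i _ => ?_
  rw [lintegral_indicator (hs i), withDensity_apply _ (hs i)]

/-- Density of a Gaussian measure on `ℝ` relative to the standard one. -/
noncomputable def gaussRatio (w : NNReal) (v x : ℝ) : ℝ :=
  gaussianPDFReal v w x / gaussianPDFReal 0 1 x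

theorem measurable_gaussRatio (w : NNReal) : Measurable (Function.uncurry (gaussRatio w)) := by
  unfold gaussRatio Function.uncurry
  simp only [gaussianPDFReal]
  fun_prop

theorem measurable_gaussRatio_apply (w : NNReal) (v : ℝ) : Measurable (gaussRatio w v) :=
  (measurable_gaussRatio w).of_uncurry_left

theorem gaussianReal_eq_withDensity_gaussRatio {w : NNReal} (hw : w ≠ 0) (v : ℝ) :
    gaussianReal v w
      = (gaussianReal 0 1).withDensity fun x => ENNReal.ofReal (gaussRatio w v x) :=
  (hasPosDensity_gaussianReal v hw).eq_withDensity_gaussianReal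

/-- Density, relative to the standard Gaussian measure on `ℝⁿ`, of the Gaussian measure with mean
`v` and independent coordinates of variances `w i`. -/
noncomputable def prodRatio {n : ℕ} (w : Fin n → NNReal) (v x : Fin n → ℝ) : ℝ≥0∞ :=
  ∏ i, ENNReal.ofReal (gaussRatio (w i) (v i) (x i))

theorem measurable_prodRatio {n : ℕ} (w : Fin n → NNReal) :
    Measurable (Function.uncurry (prodRatio w)) := by
  unfold prodRatio Function.uncurry
  refine Finset.measurable_prod _ fun i _ => ?_
  exact ((measurable_gaussRatio (w i)).comp
    (by fun_prop : Measurable fun q : (Fin n → ℝ) × (Fin n → ℝ) => (q.1 i, q.2 i))).ennreal_ofReal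

/-- Density of a Gaussian mixture relative to the standard Gaussian measure. -/
noncomputable def mixRatio {n : ℕ} (ρ : Measure (Fin n → ℝ)) (w : Fin n → NNReal)
    (x : Fin n → ℝ) : ℝ≥0∞ :=
  ∫⁻ v, prodRatio w v x ∂ρ

theorem measurable_mixRatio {n : ℕ} (ρ : Measure (Fin n → ℝ)) [IsProbabilityMeasure ρ]
    (w : Fin n → NNReal) : Measurable (mixRatio ρ w) :=
  Measurable.lintegral_prod_left (measurable_prodRatio w)

theorem map_add_pi_gaussianReal {n : ℕ} {w : Fin n → NNReal} (hw : ∀ i, w i ≠ 0)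
    (v : Fin n → ℝ) : (Measure.pi fun i => gaussianReal 0 (w i)).map (fun y => v + y)
      = (Measure.pi fun _ => gaussianReal 0 1).withDensity (prodRatio w v) := by
  have h1 : ∀ i, (gaussianReal 0 (w i)).map (fun y => v i + y) = gaussianReal (v i) (w i) := by
    intro i
    rw [gaussianReal_map_const_add, zero_add]
  have h2 : (fun y : Fin n → ℝ => v + y) = fun y i => v i + y i := rfl
  have : ∀ i, SigmaFinite ((gaussianReal 0 (w i)).map (fun y => v i + y)) := fun i => by
    rw [h1]; infer_instance
  have hs : ∀ i, SigmaFinite ((gaussianReal 0 1).withDensity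
      fun x => ENNReal.ofReal (gaussRatio (w i) (v i) x)) := fun i => by
    rw [← gaussianReal_eq_withDensity_gaussRatio (hw i)]; infer_instance
  have h3 := pi_withDensity (fun _ => gaussianReal 0 1)
    (f := fun i x => ENNReal.ofReal (gaussRatio (w i) (v i) x))
    (fun i => (measurable_gaussRatio_apply (w i) (v i)).ennreal_ofReal)
  rw [h2, Measure.pi_map_pi (fun i => by fun_prop)]
  unfold prodRatio
  rw [← h3]
  congr 1
  funext i
  rw [h1, gaussianReal_eq_withDensity_gaussRatio (hw i)]

theorem gaussMix_eq_withDensity {n : ℕ} (ρ : Measure (Fin n → ℝ)) [IsProbabilityMeasure ρ]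
    {w : Fin n → NNReal} (hw : ∀ i, w i ≠ 0) :
    gaussMix ρ w = (Measure.pi fun _ => gaussianReal 0 1).withDensity (mixRatio ρ w) := by
  refine Measure.ext_of_lintegral _ fun f hf => ?_
  have hm := measurable_prodRatio w
  rw [gaussMix, Measure.lintegral_conv hf,
    lintegral_withDensity_eq_lintegral_mul _ (measurable_mixRatio ρ w) hf]
  have h3 : ∀ v, ∫⁻ y, f (v + y) ∂(Measure.pi fun i => gaussianReal 0 (w i))
      = ∫⁻ x, prodRatio w v x * f x ∂(Measure.pi fun _ => gaussianReal 0 1) := by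
    intro v
    rw [← lintegral_map hf (measurable_const_add v), map_add_pi_gaussianReal hw,
      lintegral_withDensity_eq_lintegral_mul _ hm.of_uncurry_left hf]
    simp only [Pi.mul_apply]
  have h4 : Measurable (Function.uncurry fun v x => prodRatio w v x * f x) :=
    hm.mul (hf.comp measurable_snd)
  rw [lintegral_congr h3, lintegral_lintegral_swap h4.aemeasurable]
  refine lintegral_congr fun x => ?_
  rw [lintegral_mul_const _ hm.of_uncurry_right, Pi.mul_apply, mixRatio]

/-- The relative entropy is at most the `χ²`-divergence, written as a second moment. -/
theorem klDiv_withDensity_add_one_le {X : Type*} [MeasurableSpace X] {γ : Measure X}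
    [IsProbabilityMeasure γ] {h : X → ℝ≥0∞} (hm : Measurable h)
    [IsProbabilityMeasure (γ.withDensity h)] :
    klDiv (γ.withDensity h) γ + 1 ≤ ∫⁻ x, h x ^ 2 ∂γ := by
  have h1 : ∫⁻ x, h x ∂γ = 1 := by
    have h2 : (γ.withDensity h) univ = 1 := measure_univ
    rwa [withDensity_apply _ MeasurableSet.univ, Measure.restrict_univ] at h2
  have hfin : ∀ᵐ x ∂γ, h x < ∞ := ae_lt_top hm (by simp [h1])
  have hkl : klDiv (γ.withDensity h) γ = ∫⁻ x, ENNReal.ofReal (klFun (h x).toReal) ∂γ := by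
    rw [klDiv_eq_lintegral_klFun_of_ac (withDensity_absolutelyContinuous _ _)]
    refine lintegral_congr_ae ?_
    filter_upwards [Measure.rnDeriv_withDensity γ hm] with x hx
    rw [hx]
  have hpt : ∀ᵐ x ∂γ, ENNReal.ofReal (klFun (h x).toReal) + 2 * h x ≤ h x ^ 2 + 1 := by
    filter_upwards [hfin] with x hx
    lift h x to NNReal using hx.ne with r
    have hr : (0 : ℝ) ≤ r := r.2
    have hk : klFun (r : ℝ) + 2 * r ≤ (r : ℝ) ^ 2 + 1 := by
      have h2 : (r : ℝ) * Real.log r ≤ r * (r - 1) := by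
        rcases hr.eq_or_lt with h0 | h0
        · rw [← h0]; simp
        · exact mul_le_mul_of_nonneg_left (Real.log_le_sub_one_of_pos h0) hr
      rw [klFun_apply]
      nlinarith
    have h3 := ENNReal.ofReal_le_ofReal hk
    rw [ENNReal.ofReal_add (klFun_nonneg hr) (by positivity), ENNReal.ofReal_mul zero_le_two,
      ENNReal.ofReal_add (by positivity) zero_le_one, ENNReal.ofReal_pow hr] at h3
    simpa using h3
  have hint := lintegral_mono_ae hpt
  rw [lintegral_add_right _ (by fun_prop), lintegral_add_right _ (by fun_prop), ← hkl,
    lintegral_const_mul _ hm, h1] at hint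
  simp only [mul_one, lintegral_const, measure_univ] at hint
  have h2 : klDiv (γ.withDensity h) γ + 1 + 1 ≤ (∫⁻ x, h x ^ 2 ∂γ) + 1 := by
    rw [add_assoc, one_add_one_eq_two]; exact hint
  exact (ENNReal.add_le_add_iff_right ENNReal.one_ne_top).1 h2

/-- Mehler's kernel with correlation parameter `a`, in the scaling in which its expectation against
independent centred Gaussian variables of variance `a` equals `1`. -/
noncomputable def mehler (a v u : ℝ) : ℝ :=
  Real.exp (-Real.log (1 - a ^ 2) / 2 + (v * u - a * (v ^ 2 + u ^ 2) / 2) / (1 - a ^ 2))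

theorem mehler_pos (a v u : ℝ) : 0 < mehler a v u := Real.exp_pos _

/-- Completing the square in `x`: the product of two Gaussian densities of variance `1 - a`, divided
by the standard one, is a Gaussian density of variance `(1 - a) / (1 + a)` up to a factor, which is
Mehler's kernel. -/
theorem gaussianPDFReal_mul_gaussRatio {a : ℝ} (h0 : 0 ≤ a) (h1 : a < 1) {w s : NNReal}
    (hw : (w : ℝ) = 1 - a) (hs : (s : ℝ) = (1 - a) / (1 + a)) (v u x : ℝ) :
    gaussianPDFReal v w x * gaussRatio w u x
      = mehler a v u * gaussianPDFReal ((v + u) / (1 + a)) s x := by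
  have ha : 0 < 1 - a := by linarith
  have ha' : 0 < 1 + a := by linarith
  have haa : 1 - a ^ 2 = (1 - a) * (1 + a) := by ring
  have hpi : 0 < 2 * Real.pi := by positivity
  have hlog : Real.exp (-Real.log (1 - a ^ 2) / 2) = (√(1 - a ^ 2))⁻¹ := by
    rw [neg_div, Real.exp_neg, Real.sqrt_eq_rpow, Real.rpow_def_of_pos (by rw [haa]; positivity)]
    congr 2; ring
  have hexp : Real.exp (-(x - v) ^ 2 / (2 * (1 - a))) * Real.exp (-(x - u) ^ 2 / (2 * (1 - a)))
      = Real.exp ((v * u - a * (v ^ 2 + u ^ 2) / 2) / (1 - a ^ 2))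
        * Real.exp (-(x - (v + u) / (1 + a)) ^ 2 / (2 * ((1 - a) / (1 + a))))
        * Real.exp (-x ^ 2 / 2) := by
    rw [← Real.exp_add, ← Real.exp_add, ← Real.exp_add]
    congr 1
    rw [haa]
    field_simp
    ring
  have hc : (√(2 * Real.pi * (1 - a)))⁻¹ * (√(2 * Real.pi * (1 - a)))⁻¹
      = (√(1 - a ^ 2))⁻¹ * (√(2 * Real.pi * ((1 - a) / (1 + a))))⁻¹ * (√(2 * Real.pi))⁻¹ := by
    rw [← mul_inv, ← mul_inv, ← mul_inv]
    congr 1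
    rw [Real.mul_self_sqrt (by positivity), ← Real.sqrt_mul (by rw [haa]; positivity),
      ← Real.sqrt_mul (by rw [haa]; positivity)]
    rw [eq_comm, Real.sqrt_eq_iff_eq_sq (by rw [haa]; positivity) (by positivity), haa]
    field_simp
  have hφ : gaussianPDFReal 0 1 x ≠ 0 := (gaussianPDFReal_pos 0 1 x one_ne_zero).ne'
  rw [gaussRatio, ← mul_div_assoc, div_eq_iff hφ, mehler, Real.exp_add, hlog]
  simp only [gaussianPDFReal, hw, hs, NNReal.coe_one, mul_one, sub_zero]
  calc _ = ((√(2 * Real.pi * (1 - a)))⁻¹ * (√(2 * Real.pi * (1 - a)))⁻¹)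
        * (Real.exp (-(x - v) ^ 2 / (2 * (1 - a)))
          * Real.exp (-(x - u) ^ 2 / (2 * (1 - a)))) := by ring
    _ = _ := by rw [hc, hexp]; ring

theorem lintegral_gaussRatio_mul {a : ℝ} (h0 : 0 ≤ a) (h1 : a < 1) {w : NNReal}
    (hw : (w : ℝ) = 1 - a) (v u : ℝ) :
    ∫⁻ x, ENNReal.ofReal (gaussRatio w v x) * ENNReal.ofReal (gaussRatio w u x)
      ∂(gaussianReal 0 1) = ENNReal.ofReal (mehler a v u) := by
  have ha : 0 < 1 - a := by linarith
  have hw0 : w ≠ 0 := by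
    intro h; rw [h, NNReal.coe_zero] at hw; linarith
  have hm := measurable_gaussRatio_apply w
  have hspos : 0 < (1 - a) / (1 + a) := by positivity
  obtain ⟨s, hs⟩ : ∃ s : NNReal, (s : ℝ) = (1 - a) / (1 + a) :=
    ⟨Real.toNNReal _, Real.coe_toNNReal _ hspos.le⟩
  have hs0 : s ≠ 0 := by
    intro h; rw [h, NNReal.coe_zero] at hs; exact hspos.ne hs
  calc _ = ∫⁻ x, ENNReal.ofReal (gaussRatio w u x) ∂(gaussianReal v w) := by
        rw [gaussianReal_eq_withDensity_gaussRatio hw0 v,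
          lintegral_withDensity_eq_lintegral_mul _ (hm v).ennreal_ofReal (hm u).ennreal_ofReal]
        simp only [Pi.mul_apply]
    _ = ∫⁻ x, ENNReal.ofReal (gaussianPDFReal v w x) * ENNReal.ofReal (gaussRatio w u x) := by
        rw [(hasPosDensity_gaussianReal v hw0).eq, lintegral_withDensity_eq_lintegral_mul _
          (measurable_gaussianPDFReal v w).ennreal_ofReal (hm u).ennreal_ofReal]
        simp only [Pi.mul_apply]
    _ = ∫⁻ x, ENNReal.ofReal (mehler a v u) * gaussianPDF ((v + u) / (1 + a)) s x := by
        refine lintegral_congr fun x => ?_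
        rw [← ENNReal.ofReal_mul (gaussianPDFReal_nonneg _ _ _),
          gaussianPDFReal_mul_gaussRatio h0 h1 hw hs, gaussianPDF,
          ENNReal.ofReal_mul (mehler_pos _ _ _).le]
    _ = _ := by
        rw [lintegral_const_mul _ (measurable_gaussianPDF _ _),
          lintegral_gaussianPDF_eq_one _ hs0, mul_one]

theorem lintegral_prodRatio_mul {n : ℕ} {w : Fin n → NNReal} {a : Fin n → ℝ} (h0 : ∀ i, 0 ≤ a i)
    (h1 : ∀ i, a i < 1) (hw : ∀ i, (w i : ℝ) = 1 - a i) (v u : Fin n → ℝ) :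
    ∫⁻ x, prodRatio w v x * prodRatio w u x ∂(Measure.pi fun _ => gaussianReal 0 1)
      = ENNReal.ofReal (∏ i, mehler (a i) (v i) (u i)) := by
  have h5 : ∀ x, prodRatio w v x * prodRatio w u x
      = ∏ i, (ENNReal.ofReal (gaussRatio (w i) (v i) (x i))
        * ENNReal.ofReal (gaussRatio (w i) (u i) (x i))) := fun x => by
    rw [prodRatio, prodRatio, Finset.prod_mul_distrib]
  have h6 := lintegral_pi_prod (fun _ : Fin n => gaussianReal 0 1)
    (f := fun i x => ENNReal.ofReal (gaussRatio (w i) (v i) x)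
      * ENNReal.ofReal (gaussRatio (w i) (u i) x))
    (fun i => (measurable_gaussRatio_apply (w i) (v i)).ennreal_ofReal.mul
      (measurable_gaussRatio_apply (w i) (u i)).ennreal_ofReal)
  rw [lintegral_congr h5, h6, ENNReal.ofReal_prod_of_nonneg fun i _ => (mehler_pos _ _ _).le]
  exact Finset.prod_congr rfl fun i _ => lintegral_gaussRatio_mul (h0 i) (h1 i) (hw i) _ _

/-- The second moment of the density of a Gaussian mixture is the expectation of the product of
Mehler kernels over two independent copies of the mixing vector. -/
theorem lintegral_mixRatio_sq {n : ℕ} (ρ : Measure (Fin n → ℝ)) [IsProbabilityMeasure ρ]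
    {w : Fin n → NNReal} {a : Fin n → ℝ} (h0 : ∀ i, 0 ≤ a i) (h1 : ∀ i, a i < 1)
    (hw : ∀ i, (w i : ℝ) = 1 - a i) :
    ∫⁻ x, mixRatio ρ w x ^ 2 ∂(Measure.pi fun _ => gaussianReal 0 1)
      = ∫⁻ v, ∫⁻ u, ENNReal.ofReal (∏ i, mehler (a i) (v i) (u i)) ∂ρ ∂ρ := by
  set γ : Measure (Fin n → ℝ) := Measure.pi fun _ => gaussianReal 0 1 with hγ
  have hm := measurable_prodRatio w
  have hGu : ∀ x, Measurable fun v => prodRatio w v x := fun x => hm.of_uncurry_right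
  have hGv : ∀ v, Measurable (prodRatio w v) := fun v => hm.of_uncurry_left
  have hsq : ∀ x, mixRatio ρ w x ^ 2 = ∫⁻ v, prodRatio w v x * mixRatio ρ w x ∂ρ := by
    intro x
    rw [lintegral_mul_const _ (hGu x), sq, mixRatio]
  have hsw : ∀ z : (Fin n → ℝ) × (Fin n → ℝ) → (Fin n → ℝ) × (Fin n → ℝ), Measurable z →
      Measurable fun q => prodRatio w (z q).1 (z q).2 := fun z hz => hm.comp hz
  have h2 : Measurable fun q : (Fin n → ℝ) × (Fin n → ℝ) =>
      prodRatio w q.2 q.1 * mixRatio ρ w q.1 :=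
    (hsw Prod.swap measurable_swap).mul ((measurable_mixRatio ρ w).comp measurable_fst)
  rw [lintegral_congr hsq,
    lintegral_lintegral_swap (f := fun x v => prodRatio w v x * mixRatio ρ w x) h2.aemeasurable]
  refine lintegral_congr fun v => ?_
  have h3 : ∀ x, prodRatio w v x * mixRatio ρ w x
      = ∫⁻ u, prodRatio w v x * prodRatio w u x ∂ρ := fun x => by
    rw [lintegral_const_mul _ (hGu x), mixRatio]
  have h4 : Measurable fun q : (Fin n → ℝ) × (Fin n → ℝ) =>
      prodRatio w v q.1 * prodRatio w q.2 q.1 :=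
    ((hGv v).comp measurable_fst).mul (hsw Prod.swap measurable_swap)
  rw [lintegral_congr h3,
    lintegral_lintegral_swap (f := fun x u => prodRatio w v x * prodRatio w u x) h4.aemeasurable]
  exact lintegral_congr fun u => lintegral_prodRatio_mul h0 h1 hw v u

/-! ### Third order expansion of the Mehler kernel -/

/-- `f` is integrable with integral `c`. -/
def HasIntegralValue {X : Type*} [MeasurableSpace X] (μ : Measure X) (f : X → ℝ) (c : ℝ) : Prop :=
  Integrable f μ ∧ ∫ x, f x ∂μ = c

namespace HasIntegralValue

variable {X : Type*} [MeasurableSpace X] {μ : Measure X} {f g : X → ℝ} {c d : ℝ}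

theorem add (hf : HasIntegralValue μ f c) (hg : HasIntegralValue μ g d) :
    HasIntegralValue μ (fun x => f x + g x) (c + d) :=
  ⟨hf.1.add hg.1, by rw [integral_add hf.1 hg.1, hf.2, hg.2]⟩

theorem sub (hf : HasIntegralValue μ f c) (hg : HasIntegralValue μ g d) :
    HasIntegralValue μ (fun x => f x - g x) (c - d) :=
  ⟨hf.1.sub hg.1, by rw [integral_sub hf.1 hg.1, hf.2, hg.2]⟩

theorem const_mul (r : ℝ) (hf : HasIntegralValue μ f c) :
    HasIntegralValue μ (fun x => r * f x) (r * c) :=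
  ⟨hf.1.const_mul r, by rw [integral_const_mul, hf.2]⟩

theorem const [IsProbabilityMeasure μ] (r : ℝ) : HasIntegralValue μ (fun _ => r) r :=
  ⟨integrable_const r, by simp⟩

theorem sum {ι : Type*} {s : Finset ι} {F : ι → X → ℝ} {C : ι → ℝ}
    (h : ∀ i ∈ s, HasIntegralValue μ (F i) (C i)) :
    HasIntegralValue μ (fun x => ∑ i ∈ s, F i x) (∑ i ∈ s, C i) :=
  ⟨integrable_finsetSum s fun i hi => (h i hi).1, by
    rw [integral_finsetSum s fun i hi => (h i hi).1]
    exact Finset.sum_congr rfl fun i hi => (h i hi).2⟩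

theorem congr (hf : HasIntegralValue μ f c) (hg : ∀ x, g x = f x) (hd : d = c) :
    HasIntegralValue μ g d := by
  rw [funext hg, hd]; exact hf

end HasIntegralValue

/-- The weights `1 / (1 - a²)` occurring in the exponent of Mehler's kernel. -/
noncomputable def mehlerWeight (a : ℝ) : ℝ := 1 / (1 - a ^ 2)

/-- The bilinear part of the exponent of a product of Mehler kernels. -/
noncomputable def mehlerBilin {n : ℕ} (a v u : Fin n → ℝ) : ℝ :=
  ∑ i, mehlerWeight (a i) * (v i * u i)

/-- The quadratic part of the exponent of a product of Mehler kernels. -/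
noncomputable def mehlerQuad {n : ℕ} (a v : Fin n → ℝ) : ℝ :=
  ∑ i, mehlerWeight (a i) * a i / 2 * v i ^ 2

/-- The expectation of `mehlerQuad` for a centred vector with uncorrelated coordinates of variances
`a i`. It also bounds the logarithm of the normalising constant of the kernel. -/
noncomputable def mehlerNorm {n : ℕ} (a : Fin n → ℝ) : ℝ :=
  ∑ i, mehlerWeight (a i) * a i ^ 2 / 2

theorem mehlerWeight_mem {a : ℝ} (h0 : 0 ≤ a) (h1 : a ≤ 1 / 4) :
    1 ≤ mehlerWeight a ∧ mehlerWeight a ≤ 16 / 15 ∧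
      mehlerWeight a - 1 = mehlerWeight a * a ^ 2 := by
  have h2 : a ^ 2 ≤ 1 / 16 := by nlinarith
  have h3 : 0 < 1 - a ^ 2 := by linarith
  unfold mehlerWeight
  refine ⟨?_, ?_, ?_⟩
  · rw [le_div_iff₀ h3]; nlinarith [sq_nonneg a]
  · rw [div_le_div_iff₀ h3 (by norm_num)]; linarith
  · field_simp; ring

theorem mehler_le {a : ℝ} (h0 : 0 ≤ a) (h1 : a ≤ 1 / 4) (v u : ℝ) :
    mehler a v u ≤ Real.exp (mehlerWeight a * a ^ 2 / 2 + mehlerWeight a * (v * u)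
      - mehlerWeight a * a / 2 * v ^ 2 - mehlerWeight a * a / 2 * u ^ 2) := by
  obtain ⟨h2, -, h4⟩ := mehlerWeight_mem h0 h1
  have h3 : 0 < mehlerWeight a := by linarith
  have hlog : -Real.log (1 - a ^ 2) ≤ mehlerWeight a * a ^ 2 := by
    have h5 := Real.log_le_sub_one_of_pos h3
    rw [h4, mehlerWeight, one_div, Real.log_inv] at h5
    simpa [mehlerWeight] using h5
  unfold mehler
  refine Real.exp_le_exp.2 ?_
  have h6 : (v * u - a * (v ^ 2 + u ^ 2) / 2) / (1 - a ^ 2)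
      = mehlerWeight a * (v * u) - mehlerWeight a * a / 2 * v ^ 2
        - mehlerWeight a * a / 2 * u ^ 2 := by
    rw [mehlerWeight]; ring
  rw [h6]
  linarith

theorem prod_mehler_le_exp {n : ℕ} {a : Fin n → ℝ} (h0 : ∀ i, 0 ≤ a i) (h1 : ∀ i, a i ≤ 1 / 4)
    (v u : Fin n → ℝ) : ∏ i, mehler (a i) (v i) (u i)
      ≤ Real.exp (mehlerNorm a + mehlerBilin a v u - mehlerQuad a v - mehlerQuad a u) := by
  calc _ ≤ ∏ i, Real.exp (mehlerWeight (a i) * a i ^ 2 / 2 + mehlerWeight (a i) * (v i * u i)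
        - mehlerWeight (a i) * a i / 2 * v i ^ 2 - mehlerWeight (a i) * a i / 2 * u i ^ 2) :=
        Finset.prod_le_prod (fun i _ => (mehler_pos _ _ _).le)
          fun i _ => mehler_le (h0 i) (h1 i) _ _
    _ = _ := by
        rw [← Real.exp_sum, Finset.sum_sub_distrib, Finset.sum_sub_distrib, Finset.sum_add_distrib]
        rfl

section Bounds

variable {n : ℕ} {a v u : Fin n → ℝ} {t : ℝ}

theorem abs_mehlerBilin_le (h0 : ∀ i, 0 ≤ a i) (h1 : ∀ i, a i ≤ 1 / 4)
    (hv : ∑ i, v i ^ 2 ≤ t) (hu : ∑ i, u i ^ 2 ≤ t) : |mehlerBilin a v u| ≤ 16 / 15 * t := by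
  calc |mehlerBilin a v u| ≤ ∑ i, |mehlerWeight (a i) * (v i * u i)| :=
        Finset.abs_sum_le_sum_abs _ _
    _ ≤ ∑ i, 16 / 15 * ((v i ^ 2 + u i ^ 2) / 2) := by
        refine Finset.sum_le_sum fun i _ => ?_
        obtain ⟨h2, h3, -⟩ := mehlerWeight_mem (h0 i) (h1 i)
        rw [abs_mul, abs_of_nonneg (by linarith)]
        refine mul_le_mul h3 ?_ (abs_nonneg _) (by norm_num)
        rw [abs_le]
        constructor <;> nlinarith [sq_nonneg (v i + u i), sq_nonneg (v i - u i)]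
    _ = 16 / 15 * ((∑ i, v i ^ 2 + ∑ i, u i ^ 2) / 2) := by
        rw [← Finset.mul_sum, ← Finset.sum_div, Finset.sum_add_distrib]
    _ ≤ 16 / 15 * t := by linarith

theorem mehlerQuad_mem (h0 : ∀ i, 0 ≤ a i) (h1 : ∀ i, a i ≤ 1 / 4) (hat : ∀ i, a i ≤ t)
    (ht0 : 0 ≤ t) (hv : ∑ i, v i ^ 2 ≤ t) :
    0 ≤ mehlerQuad a v ∧ mehlerQuad a v ≤ 8 / 15 * t ^ 2 := by
  constructor
  · refine Finset.sum_nonneg fun i _ => ?_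
    obtain ⟨h2, -, -⟩ := mehlerWeight_mem (h0 i) (h1 i)
    have := h0 i
    positivity
  · calc mehlerQuad a v ≤ ∑ i, 8 / 15 * t * v i ^ 2 := by
          refine Finset.sum_le_sum fun i _ => mul_le_mul_of_nonneg_right ?_ (sq_nonneg _)
          obtain ⟨h2, h3, -⟩ := mehlerWeight_mem (h0 i) (h1 i)
          nlinarith [h0 i, hat i]
      _ = 8 / 15 * t * ∑ i, v i ^ 2 := by rw [Finset.mul_sum]
      _ ≤ 8 / 15 * t ^ 2 := by nlinarith

theorem mehlerNorm_mem (h0 : ∀ i, 0 ≤ a i) (h1 : ∀ i, a i ≤ 1 / 4) (hat : ∀ i, a i ≤ t)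
    (ht0 : 0 ≤ t) (hsum : ∑ i, a i ≤ t) : 0 ≤ mehlerNorm a ∧ mehlerNorm a ≤ 8 / 15 * t ^ 2 := by
  constructor
  · refine Finset.sum_nonneg fun i _ => ?_
    obtain ⟨h2, -, -⟩ := mehlerWeight_mem (h0 i) (h1 i)
    positivity
  · calc mehlerNorm a ≤ ∑ i, 8 / 15 * t * a i := by
          refine Finset.sum_le_sum fun i _ => ?_
          obtain ⟨h2, h3, -⟩ := mehlerWeight_mem (h0 i) (h1 i)
          have h4 : mehlerWeight (a i) * a i ≤ 16 / 15 * t := by nlinarith [h0 i, hat i]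
          nlinarith [h0 i]
      _ = 8 / 15 * t * ∑ i, a i := by rw [Finset.mul_sum]
      _ ≤ 8 / 15 * t ^ 2 := by nlinarith

/-- The cubic coefficient `2 / 9 = 4 / (3! * 3)` is that of `Real.exp_bound` at order three. -/
theorem exp_le_cubic {x : ℝ} (hx : |x| ≤ 1) :
    Real.exp x ≤ 1 + x + x ^ 2 / 2 + 2 / 9 * |x| ^ 3 := by
  have h := (abs_le.1 (Real.exp_bound hx (n := 3) (by norm_num))).2
  simp only [Finset.sum_range_succ, Finset.sum_range_zero, Nat.factorial] at h
  norm_num at h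
  nlinarith

/-- Third order expansion of a product of Mehler kernels. The error terms of order at least three
are collected in a multiple of `t ^ 3`, except for those whose expectation vanishes. -/
theorem prod_mehler_le (h0 : ∀ i, 0 ≤ a i) (hat : ∀ i, a i ≤ t) (ht0 : 0 ≤ t) (ht : t ≤ 1 / 4)
    (hsum : ∑ i, a i ≤ t) (hv : ∑ i, v i ^ 2 ≤ t) (hu : ∑ i, u i ^ 2 ≤ t) :
    ∏ i, mehler (a i) (v i) (u i)
      ≤ (1 + mehlerNorm a - mehlerQuad a v + 7 / 10 * t ^ 3)
        + (1 + mehlerNorm a - mehlerQuad a v) * mehlerBilin a v u - mehlerQuad a u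
        + 1 / 2 * mehlerBilin a v u ^ 2 - mehlerBilin a v u * mehlerQuad a u := by
  have h1 : ∀ i, a i ≤ 1 / 4 := fun i => (hat i).trans ht
  have hU := abs_mehlerBilin_le h0 h1 hv hu
  obtain ⟨hv0, hv1⟩ := mehlerQuad_mem h0 h1 hat ht0 hv
  obtain ⟨hu0, hu1⟩ := mehlerQuad_mem h0 h1 hat ht0 hu
  obtain ⟨hn0, hn1⟩ := mehlerNorm_mem h0 h1 hat ht0 hsum
  refine (prod_mehler_le_exp h0 h1 v u).trans ?_
  set U := mehlerBilin a v u
  set q := mehlerQuad a v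
  set q' := mehlerQuad a u
  set N := mehlerNorm a
  have ht2 : t ^ 2 ≤ t / 4 := by nlinarith
  have hr : |N - q - q'| ≤ 16 / 15 * t ^ 2 := by rw [abs_le]; constructor <;> linarith
  have hx : |N + U - q - q'| ≤ 4 / 3 * t := by
    have h2 : N + U - q - q' = U + (N - q - q') := by ring
    rw [h2]
    refine (abs_add_le _ _).trans ?_
    linarith
  have hcube := pow_le_pow_left₀ (abs_nonneg _) hx 3
  have hrsq := pow_le_pow_left₀ (abs_nonneg _) hr 2
  rw [sq_abs] at hrsq
  have ht4 : t ^ 4 ≤ t ^ 3 / 4 := by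
    have : 0 ≤ t ^ 3 := by positivity
    nlinarith
  have hexp := exp_le_cubic (hx.trans (by linarith))
  have ht3 : 0 ≤ t ^ 3 := by positivity
  have hid : 1 + (N + U - q - q') + (N + U - q - q') ^ 2 / 2
      = (1 + N - q) + (1 + N - q) * U - q' + 1 / 2 * U ^ 2 - U * q' + (N - q - q') ^ 2 / 2 := by
    ring
  -- the remainder is at most `(2 / 9 * 64 / 27 + 128 / 225 / 4) * t ^ 3`, and this coefficient is
  -- below `7 / 10`
  have h5 : (4 / 3 * t) ^ 3 = 64 / 27 * t ^ 3 := by ring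
  have h6 : (16 / 15 * t ^ 2) ^ 2 = 256 / 225 * t ^ 4 := by ring
  rw [h5] at hcube
  rw [h6] at hrsq
  linarith

end Bounds

/-- The expectation of the product of Mehler kernels over two independent copies of a centred
bounded vector whose covariance matrix is diagonal with the entries `a i`. The terms of order one
and two cancel because the first two moments agree with those of the Gaussian vector. -/
theorem lintegral_prod_mehler_le {n : ℕ} (ρ : Measure (Fin n → ℝ)) [IsProbabilityMeasure ρ]
    {a : Fin n → ℝ} {t : ℝ} (ht : t ≤ 1 / 4) (hmean : ∀ i, ∫ v, v i ∂ρ = 0)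
    (hcov : ∀ i j, ∫ v, v i * v j ∂ρ = if i = j then a i else 0)
    (hbdd : ∀ᵐ v ∂ρ, ∑ i, v i ^ 2 ≤ t) :
    (∀ i, 0 ≤ a i) ∧ (∀ i, a i ≤ t) ∧ 0 ≤ t ∧
    ∫⁻ v, ∫⁻ u, ENNReal.ofReal (∏ i, mehler (a i) (v i) (u i)) ∂ρ ∂ρ
      ≤ ENNReal.ofReal (1 + t ^ 3) := by
  have ht0 : 0 ≤ t := by
    obtain ⟨v, hv⟩ := hbdd.exists
    exact (Finset.sum_nonneg fun i _ => sq_nonneg _).trans hv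
  have hcoord : ∀ᵐ v ∂ρ, ∀ i, |v i| ≤ 1 := by
    filter_upwards [hbdd] with v hv i
    have h1 := Finset.single_le_sum (f := fun i => v i ^ 2) (fun i _ => sq_nonneg _)
      (Finset.mem_univ i)
    exact (sq_le_one_iff_abs_le_one _).1 (by linarith)
  have hlin : ∀ i, HasIntegralValue ρ (fun v => v i) 0 := fun i =>
    ⟨Integrable.of_bound (measurable_pi_apply i).aestronglyMeasurable 1
      (by filter_upwards [hcoord] with v hv using hv i), hmean i⟩
  have hprod : ∀ i j, HasIntegralValue ρ (fun v => v i * v j) (if i = j then a i else 0) :=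
    fun i j => ⟨Integrable.of_bound (by fun_prop) 1 (by
      filter_upwards [hcoord] with v hv
      rw [norm_mul]
      exact mul_le_one₀ (hv i) (norm_nonneg _) (hv j)), hcov i j⟩
  have hsq : ∀ i, HasIntegralValue ρ (fun v => v i ^ 2) (a i) := fun i =>
    (hprod i i).congr (fun v => sq _) (by simp)
  have h0 : ∀ i, 0 ≤ a i := fun i => by
    rw [← (hsq i).2]; exact integral_nonneg fun v => sq_nonneg _
  have hsum : ∑ i, a i ≤ t := by
    have h1 := HasIntegralValue.sum (s := Finset.univ) fun i _ => hsq i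
    rw [← h1.2]
    calc _ ≤ ∫ _, t ∂ρ := integral_mono_ae h1.1 (integrable_const t) hbdd
      _ = t := by simp
  have hat : ∀ i, a i ≤ t := fun i =>
    (Finset.single_le_sum (fun i _ => h0 i) (Finset.mem_univ i)).trans hsum
  refine ⟨h0, hat, ht0, ?_⟩
  have h1 : ∀ i, a i ≤ 1 / 4 := fun i => (hat i).trans ht
  have hquad : HasIntegralValue ρ (mehlerQuad a) (mehlerNorm a) :=
    (HasIntegralValue.sum (s := Finset.univ) fun i _ =>
      (hsq i).const_mul (mehlerWeight (a i) * a i / 2)).congr (fun v => rfl)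
      (Finset.sum_congr rfl fun i _ => by ring)
  have hquadm : Measurable (mehlerQuad a) := by unfold mehlerQuad; fun_prop
  -- the third moments; their values are irrelevant
  set m : Fin n → ℝ := fun i => ∫ u, u i * mehlerQuad a u ∂ρ with hm
  have hthird : ∀ i, HasIntegralValue ρ (fun u => u i * mehlerQuad a u) (m i) := fun i => by
    refine ⟨Integrable.of_bound (by fun_prop) 1 ?_, rfl⟩
    filter_upwards [hcoord, hbdd] with u hu hu'
    obtain ⟨h2, h3⟩ := mehlerQuad_mem h0 h1 hat ht0 hu'
    rw [norm_mul]
    refine mul_le_one₀ (hu i) (norm_nonneg _) ?_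
    rw [Real.norm_of_nonneg h2]
    nlinarith
  have hbil : ∀ v, HasIntegralValue ρ (fun u => mehlerBilin a v u) 0 := fun v =>
    (HasIntegralValue.sum (s := Finset.univ) fun i _ =>
      (hlin i).const_mul (mehlerWeight (a i) * v i)).congr
      (fun u => Finset.sum_congr rfl fun i _ => by ring) (by simp)
  have hbilsq : ∀ v, HasIntegralValue ρ (fun u => mehlerBilin a v u ^ 2)
      (∑ i, mehlerWeight (a i) ^ 2 * a i * v i ^ 2) := fun v => by
    refine (HasIntegralValue.sum (s := Finset.univ) fun i _ =>
      HasIntegralValue.sum (s := Finset.univ) fun j _ => (hprod i j).const_mul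
        (mehlerWeight (a i) * v i * (mehlerWeight (a j) * v j))).congr (fun u => ?_) ?_
    · rw [mehlerBilin, sq, Finset.sum_mul_sum]
      exact Finset.sum_congr rfl fun i _ => Finset.sum_congr rfl fun j _ => by ring
    · refine Finset.sum_congr rfl fun i _ => ?_
      simp only [mul_ite, mul_zero, Finset.sum_ite_eq, Finset.mem_univ, if_true]
      ring
  have hbilquad : ∀ v, HasIntegralValue ρ (fun u => mehlerBilin a v u * mehlerQuad a u)
      (∑ i, mehlerWeight (a i) * m i * v i) := fun v =>
    (HasIntegralValue.sum (s := Finset.univ) fun i _ =>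
      (hthird i).const_mul (mehlerWeight (a i) * v i)).congr
      (fun u => by
        rw [mehlerBilin, Finset.sum_mul]
        exact Finset.sum_congr rfl fun i _ => by ring)
      (Finset.sum_congr rfl fun i _ => by ring)
  set C := 7 / 10 * t ^ 3 with hC
  -- the majorant and its partial integral
  set F : (Fin n → ℝ) → (Fin n → ℝ) → ℝ := fun v u =>
    (1 + mehlerNorm a - mehlerQuad a v + C)
      + (1 + mehlerNorm a - mehlerQuad a v) * mehlerBilin a v u - mehlerQuad a u
      + 1 / 2 * mehlerBilin a v u ^ 2 - mehlerBilin a v u * mehlerQuad a u with hF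
  set J : (Fin n → ℝ) → ℝ := fun v => 1 + C - mehlerQuad a v
    + ∑ i, mehlerWeight (a i) ^ 2 * a i / 2 * v i ^ 2 - ∑ i, mehlerWeight (a i) * m i * v i with hJ
  have hFJ : ∀ v, HasIntegralValue ρ (F v) (J v) := fun v => by
    refine (((((HasIntegralValue.const (1 + mehlerNorm a - mehlerQuad a v + C)).add
      ((hbil v).const_mul (1 + mehlerNorm a - mehlerQuad a v))).sub hquad).add
      ((hbilsq v).const_mul (1 / 2))).sub (hbilquad v)).congr (fun u => rfl) ?_
    have h2 : 1 / 2 * ∑ i, mehlerWeight (a i) ^ 2 * a i * v i ^ 2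
        = ∑ i, mehlerWeight (a i) ^ 2 * a i / 2 * v i ^ 2 := by
      rw [Finset.mul_sum]; exact Finset.sum_congr rfl fun i _ => by ring
    rw [h2, hJ]
    ring
  have hJint : HasIntegralValue ρ J
      (1 + C - mehlerNorm a + ∑ i, mehlerWeight (a i) ^ 2 * a i / 2 * a i) := by
    refine ((((HasIntegralValue.const (1 + C)).sub hquad).add
      (HasIntegralValue.sum (s := Finset.univ) fun i _ =>
        (hsq i).const_mul (mehlerWeight (a i) ^ 2 * a i / 2))).sub
      (HasIntegralValue.sum (s := Finset.univ) fun i _ =>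
        (hlin i).const_mul (mehlerWeight (a i) * m i))).congr (fun v => rfl) ?_
    simp
  have hpt : ∀ᵐ v ∂ρ, ∀ᵐ u ∂ρ, ∏ i, mehler (a i) (v i) (u i) ≤ F v u := by
    filter_upwards [hbdd] with v hv
    filter_upwards [hbdd] with u hu
    exact prod_mehler_le h0 hat ht0 ht hsum hv hu
  have hinner : ∀ᵐ v ∂ρ, ∫⁻ u, ENNReal.ofReal (∏ i, mehler (a i) (v i) (u i)) ∂ρ
      ≤ ENNReal.ofReal (J v) ∧ 0 ≤ J v := by
    filter_upwards [hpt] with v hv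
    have hnn : 0 ≤ᵐ[ρ] F v := by
      filter_upwards [hv] with u hu
      exact (Finset.prod_nonneg fun i _ => (mehler_pos _ _ _).le).trans hu
    rw [← (hFJ v).2]
    refine ⟨?_, integral_nonneg_of_ae hnn⟩
    rw [ofReal_integral_eq_lintegral_ofReal (hFJ v).1 hnn]
    exact lintegral_mono_ae (by filter_upwards [hv] with u hu using ENNReal.ofReal_le_ofReal hu)
  calc _ ≤ ∫⁻ v, ENNReal.ofReal (J v) ∂ρ :=
        lintegral_mono_ae (by filter_upwards [hinner] with v hv using hv.1)
    _ = ENNReal.ofReal (1 + C - mehlerNorm a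
          + ∑ i, mehlerWeight (a i) ^ 2 * a i / 2 * a i) := by
        rw [← hJint.2, ofReal_integral_eq_lintegral_ofReal hJint.1
          (by filter_upwards [hinner] with v hv using hv.2)]
    _ ≤ _ := by
        refine ENNReal.ofReal_le_ofReal ?_
        -- the second order terms cancel up to `t ^ 3 / 4`, and `7 / 10 + 1 / 4 ≤ 1`
        have hdiff : (∑ i, mehlerWeight (a i) ^ 2 * a i / 2 * a i) - mehlerNorm a
            ≤ t ^ 3 / 4 := by
          rw [mehlerNorm, ← Finset.sum_sub_distrib]
          calc _ ≤ ∑ i, t ^ 2 / 4 * a i := by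
                refine Finset.sum_le_sum fun i _ => ?_
                obtain ⟨h2, h3, h4⟩ := mehlerWeight_mem (h0 i) (h1 i)
                have h5 : mehlerWeight (a i) ^ 2 * a i / 2 * a i - mehlerWeight (a i) * a i ^ 2 / 2
                    = mehlerWeight (a i) ^ 2 / 2 * (a i ^ 2 * a i) * a i := by
                  linear_combination (mehlerWeight (a i) * a i ^ 2 / 2) * h4
                rw [h5]
                refine mul_le_mul_of_nonneg_right ?_ (h0 i)
                have h6 : mehlerWeight (a i) ^ 2 / 2 ≤ 1 := by nlinarith
                have h7 : a i ^ 2 * a i ≤ t ^ 2 * (1 / 4) :=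
                  mul_le_mul (pow_le_pow_left₀ (h0 i) (hat i) 2) (h1 i) (h0 i) (sq_nonneg t)
                have h8 : 0 ≤ a i ^ 2 * a i := mul_nonneg (sq_nonneg _) (h0 i)
                nlinarith
            _ = t ^ 2 / 4 * ∑ i, a i := by rw [Finset.mul_sum]
            _ ≤ t ^ 2 / 4 * t := mul_le_mul_of_nonneg_left hsum (by positivity)
            _ = t ^ 3 / 4 := by ring
        have : 0 ≤ t ^ 3 := by positivity
        linarith

/-- A bounded centred vector with the covariance matrix of a Gaussian summand can replace this
summand at a cost, in relative entropy, of the third power of the squared bound. -/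
theorem klDiv_gaussMix_le {n : ℕ} (ρ : Measure (Fin n → ℝ)) [IsProbabilityMeasure ρ]
    {a : Fin n → ℝ} {w : Fin n → NNReal} {t : ℝ} (ht : t ≤ 1 / 4)
    (hmean : ∀ i, ∫ v, v i ∂ρ = 0)
    (hcov : ∀ i j, ∫ v, v i * v j ∂ρ = if i = j then a i else 0)
    (hbdd : ∀ᵐ v ∂ρ, ∑ i, v i ^ 2 ≤ t) (hw : ∀ i, (w i : ℝ) = 1 - a i) :
    klDiv (gaussMix ρ w) (Measure.pi fun _ => gaussianReal 0 1) ≤ ENNReal.ofReal (t ^ 3) := by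
  obtain ⟨h0, hat, ht0, hle⟩ := lintegral_prod_mehler_le ρ ht hmean hcov hbdd
  have h1 : ∀ i, a i < 1 := fun i => by linarith [hat i]
  have hw0 : ∀ i, w i ≠ 0 := fun i h => by
    have h2 := hw i
    rw [h, NNReal.coe_zero] at h2
    linarith [h1 i]
  rw [← lintegral_mixRatio_sq ρ h0 h1 hw] at hle
  have heq := gaussMix_eq_withDensity ρ hw0
  have : IsProbabilityMeasure
      ((Measure.pi fun _ : Fin n => gaussianReal 0 1).withDensity (mixRatio ρ w)) := by
    rw [← heq]; infer_instance
  have h3 := (klDiv_withDensity_add_one_le (measurable_mixRatio ρ w)).trans hle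
  rw [← heq, add_comm 1, ENNReal.ofReal_add (by positivity) zero_le_one, ENNReal.ofReal_one] at h3
  exact (ENNReal.add_le_add_iff_right ENNReal.one_ne_top).1 h3

/-! ### Exchange of the summands -/

/-- The centred Gaussian measure on Euclidean space with independent coordinates of variances
`m i`. Negative values of `m i` are read as `0`. -/
noncomputable def diagGaussian {d : ℕ} (m : Fin d → ℝ) : Measure (EuclideanSpace ℝ (Fin d)) :=
  (Measure.pi fun i => gaussianReal 0 (m i).toNNReal).map (WithLp.toLp 2)

instance {d : ℕ} (m : Fin d → ℝ) : IsProbabilityMeasure (diagGaussian m) :=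
  Measure.isProbabilityMeasure_map (by fun_prop)

theorem diagGaussian_one (d : ℕ) :
    diagGaussian (fun _ : Fin d => 1) = stdGaussian (EuclideanSpace ℝ (Fin d)) := by
  rw [← map_pi_eq_stdGaussian, diagGaussian]
  simp

/-- Rescaling of the coordinates by the factors `r i`. -/
noncomputable def scaleCLM {d : ℕ} (r : Fin d → ℝ) :
    (Fin d → ℝ) →L[ℝ] EuclideanSpace ℝ (Fin d) :=
  (EuclideanSpace.equiv (Fin d) ℝ).symm.toContinuousLinearMap ∘L
    ContinuousLinearMap.pi fun i => r i • ContinuousLinearMap.proj i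

theorem scaleCLM_apply {d : ℕ} (r : Fin d → ℝ) (x : Fin d → ℝ) :
    scaleCLM r x = WithLp.toLp 2 fun i => r i * x i := rfl

theorem map_scaleCLM_pi {d : ℕ} {m : Fin d → ℝ} (hm : ∀ i, 0 ≤ m i) (w : Fin d → NNReal) :
    (Measure.pi fun i => gaussianReal 0 (w i)).map (scaleCLM fun i => √(m i))
      = diagGaussian fun i => m i * w i := by
  have h1 : ∀ i, (gaussianReal 0 (w i)).map (fun x => √(m i) * x)
      = gaussianReal 0 (m i * w i).toNNReal := fun i => by
    rw [gaussianReal_map_const_mul]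
    congr 1
    · simp
    · ext
      simp only [NNReal.coe_mul]
      rw [Real.coe_toNNReal _ (mul_nonneg (hm i) (NNReal.coe_nonneg _)), NNReal.coe_mk,
        Real.sq_sqrt (hm i)]
  have h2 : (scaleCLM fun i => √(m i) : (Fin d → ℝ) → EuclideanSpace ℝ (Fin d))
      = WithLp.toLp 2 ∘ fun x i => √(m i) * x i := rfl
  have : ∀ i, SigmaFinite ((gaussianReal 0 (w i)).map (fun x => √(m i) * x)) := fun i => by
    rw [h1]; infer_instance
  rw [h2, ← Measure.map_map (by fun_prop) (by fun_prop), Measure.pi_map_pi (fun i => by fun_prop),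
    diagGaussian]
  simp_rw [h1]

theorem edist_scaleCLM_sq_le {d : ℕ} {r : Fin d → ℝ} (hr0 : ∀ i, 0 ≤ r i) (hr : ∀ i, r i ≤ 1)
    (x y : Fin d → ℝ) : edist (scaleCLM r x) (scaleCLM r y) ^ (2 : ℝ)
      ≤ ∑ i, ENNReal.ofReal ((x i - y i) ^ 2) := by
  rw [edist_dist, ENNReal.ofReal_rpow_of_nonneg dist_nonneg zero_le_two, Real.rpow_two,
    ← ENNReal.ofReal_sum_of_nonneg fun i _ => sq_nonneg _]
  refine ENNReal.ofReal_le_ofReal ?_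
  rw [EuclideanSpace.dist_eq, Real.sq_sqrt (Finset.sum_nonneg fun i _ => sq_nonneg _)]
  refine Finset.sum_le_sum fun i _ => ?_
  rw [Real.dist_eq, sq_abs]
  simp only [scaleCLM_apply]
  have h1 : r i ^ 2 ≤ 1 := pow_le_one₀ (hr0 i) (hr i)
  nlinarith [sq_nonneg (x i - y i)]

/-- Exchange of one summand: in the presence of a Gaussian vector with independent coordinates of
variances between `4 / 5` and `1`, part of it may be replaced by a bounded centred vector with the
same covariance. -/
theorem coupledWithin_exchange {d : ℕ} (ρ : Measure (EuclideanSpace ℝ (Fin d)))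
    [IsProbabilityMeasure ρ] {s m : Fin d → ℝ} {q : ℝ} (hq : q ≤ 1 / 5)
    (hmean : ∀ i, ∫ x, x i ∂ρ = 0)
    (hcov : ∀ i j, ∫ x, x i * x j ∂ρ = if i = j then s i else 0)
    (hbdd : ∀ᵐ x ∂ρ, ∑ i, x i ^ 2 ≤ q) (hm0 : ∀ i, 4 / 5 ≤ m i) (hm1 : ∀ i, m i ≤ 1) :
    CoupledWithin (ENNReal.ofReal √(2 * (5 / 4 * q) ^ 3))
      (diagGaussian (fun i => m i - s i) ∗ ρ) (diagGaussian m) := by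
  have hmpos : ∀ i, 0 < m i := fun i => by linarith [hm0 i]
  have hsq : ∀ i, √(m i) ^ 2 = m i := fun i => Real.sq_sqrt (hmpos i).le
  have hspos : ∀ i, 0 < √(m i) := fun i => Real.sqrt_pos.2 (hmpos i)
  set g : EuclideanSpace ℝ (Fin d) → Fin d → ℝ := fun x i => (√(m i))⁻¹ * x i with hg
  have hgm : Measurable g := by fun_prop
  set ρ' := ρ.map g with hρ'
  have : IsProbabilityMeasure ρ' := Measure.isProbabilityMeasure_map hgm.aemeasurable
  set a : Fin d → ℝ := fun i => s i / m i with ha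
  have hmean' : ∀ i, ∫ v, v i ∂ρ' = 0 := fun i => by
    rw [hρ', integral_map hgm.aemeasurable (measurable_pi_apply i).aestronglyMeasurable]
    simp only [hg]
    rw [integral_const_mul, hmean, mul_zero]
  have hcov' : ∀ i j, ∫ v, v i * v j ∂ρ' = if i = j then a i else 0 := fun i j => by
    have hij : Measurable fun v : Fin d → ℝ => v i * v j := by fun_prop
    rw [hρ', integral_map hgm.aemeasurable hij.aestronglyMeasurable]
    have h1 : ∀ x : EuclideanSpace ℝ (Fin d), g x i * g x j
        = ((√(m i))⁻¹ * (√(m j))⁻¹) * (x i * x j) := fun x => by simp only [hg]; ring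
    simp_rw [h1]
    rw [integral_const_mul, hcov]
    split_ifs with h
    · rw [← h, ← mul_inv, Real.mul_self_sqrt (hmpos i).le, ha]
      simp only
      rw [div_eq_inv_mul]
    · ring
  have hbdd' : ∀ᵐ v ∂ρ', ∑ i, v i ^ 2 ≤ 5 / 4 * q := by
    rw [hρ', ae_map_iff hgm.aemeasurable (measurableSet_le (by fun_prop) measurable_const)]
    filter_upwards [hbdd] with x hx
    calc ∑ i, g x i ^ 2 ≤ ∑ i, 5 / 4 * x i ^ 2 := by
          refine Finset.sum_le_sum fun i _ => ?_
          simp only [hg]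
          rw [mul_pow, inv_pow, hsq]
          refine mul_le_mul_of_nonneg_right ?_ (sq_nonneg _)
          rw [inv_le_comm₀ (hmpos i) (by norm_num)]
          linarith [hm0 i]
      _ = 5 / 4 * ∑ i, x i ^ 2 := by rw [Finset.mul_sum]
      _ ≤ 5 / 4 * q := by linarith
  have ht : 5 / 4 * q ≤ 1 / 4 := by linarith
  obtain ⟨h0, hat, ht0, -⟩ := lintegral_prod_mehler_le ρ' ht hmean' hcov' hbdd'
  set w : Fin d → NNReal := fun i => (1 - a i).toNNReal with hwdef
  have hw : ∀ i, (w i : ℝ) = 1 - a i := fun i => Real.coe_toNNReal _ (by linarith [hat i])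
  have hw0 : ∀ i, w i ≠ 0 := fun i h => by
    have h2 := hw i
    rw [h, NNReal.coe_zero] at h2
    linarith [hat i]
  have hw1 : ∀ i, w i ≤ 1 := fun i => by
    rw [← NNReal.coe_le_coe, hw, NNReal.coe_one]; linarith [h0 i]
  have hb : ∀ᵐ v ∂ρ', ∀ i, |v i| ≤ 1 := by
    filter_upwards [hbdd'] with v hv i
    have h1 := Finset.single_le_sum (f := fun i => v i ^ 2) (fun i _ => sq_nonneg _)
      (Finset.mem_univ i)
    exact (sq_le_one_iff_abs_le_one _).1 (by linarith)
  obtain ⟨π, hπ, hcost⟩ := exists_coupling_gaussMix_le_klDiv ρ' w hw0 hw1 hb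
  have hkl := klDiv_gaussMix_le ρ' ht hmean' hcov' hbdd' hw
  set f := scaleCLM fun i => √(m i) with hf
  have hfm : Measurable f := f.continuous.measurable
  have hff : Measurable (Prod.map f f) := hfm.prodMap hfm
  have hfg : f ∘ g = id := by
    funext x
    ext i
    simp only [hf, hg, Function.comp, scaleCLM_apply, id]
    rw [mul_inv_cancel_left₀ (hspos i).ne']
  have hlaw : (gaussMix ρ' w).map f = diagGaussian (fun i => m i - s i) ∗ ρ := by
    rw [gaussMix, Measure.map_conv_continuousLinearMap, map_scaleCLM_pi fun i => (hmpos i).le,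
      hρ', Measure.map_map hfm hgm, hfg, Measure.map_id, Measure.conv_comm]
    congr 2
    funext i
    rw [hw, ha]
    have := (hmpos i).ne'
    field_simp
  have hlaw' : (Measure.pi fun _ : Fin d => gaussianReal 0 1).map f = diagGaussian m := by
    rw [hf, map_scaleCLM_pi (fun i => (hmpos i).le) (fun _ => 1)]
    simp
  refine ⟨π.map (Prod.map f f), ⟨?_, ?_⟩, ?_⟩
  · rw [← hlaw, ← hπ.1, Measure.fst, Measure.fst, Measure.map_map measurable_fst hff,
      Measure.map_map hfm measurable_fst]
    rfl
  · rw [← hlaw', ← hπ.2, Measure.snd, Measure.snd, Measure.map_map measurable_snd hff,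
      Measure.map_map hfm measurable_snd]
    rfl
  · rw [lintegral_map CoupledWithin.measurable_edist_rpow hff]
    calc _ ≤ ∫⁻ z, ∑ i, ENNReal.ofReal ((z.1 i - z.2 i) ^ 2) ∂π :=
          lintegral_mono fun z => edist_scaleCLM_sq_le (fun i => Real.sqrt_nonneg _)
            (fun i => Real.sqrt_le_one.2 (hm1 i)) z.1 z.2
      _ ≤ 2 * ENNReal.ofReal ((5 / 4 * q) ^ 3) := hcost.trans (mul_le_mul_right hkl 2)
      _ = _ := by
          rw [ENNReal.ofReal_rpow_of_nonneg (Real.sqrt_nonneg _) zero_le_two, Real.rpow_two,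
            Real.sq_sqrt (by positivity), ENNReal.ofReal_mul zero_le_two]
          simp

/-- The exchange of all summands, one after the other. -/
theorem coupledWithin_sum {Ω : Type*} [MeasurableSpace Ω] {P : Measure Ω} [IsProbabilityMeasure P]
    {d B : ℕ} {W : Fin B → Ω → EuclideanSpace ℝ (Fin d)} (hind : iIndepFun W P)
    (hWm : ∀ i, AEMeasurable (W i) P) {s : Fin d → ℝ} {q : ℝ} (hq0 : 0 ≤ q) (hq : B * q ≤ 1 / 5)
    (hmean : ∀ k i, ∫ ω, W k ω i ∂P = 0)
    (hcov : ∀ k i j, ∫ ω, W k ω i * W k ω j ∂P = if i = j then s i else 0)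
    (hbdd : ∀ k, ∀ᵐ ω ∂P, ∑ i, W k ω i ^ 2 ≤ q) (hs0 : ∀ i, 0 ≤ s i) (hsq : ∀ i, s i ≤ q)
    (A : Finset (Fin B)) :
    CoupledWithin (ENNReal.ofReal (A.card * √(2 * (5 / 4 * q) ^ 3)))
      (diagGaussian (fun i => 1 - A.card * s i) ∗ P.map (∑ k ∈ A, W k))
      (stdGaussian (EuclideanSpace ℝ (Fin d))) := by
  classical
  induction A using Finset.induction_on with
  | empty =>
    have h1 : P.map (∑ k ∈ (∅ : Finset (Fin B)), W k) = Measure.dirac 0 := by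
      have h2 : (∑ k ∈ (∅ : Finset (Fin B)), W k) = fun _ => 0 := by
        funext ω; simp
      rw [h2, Measure.map_const]
      simp
    rw [h1]
    simp only [Finset.card_empty, Nat.cast_zero, zero_mul, sub_zero, diagGaussian_one,
      Measure.conv_dirac_zero]
    exact CoupledWithin.refl _ _
  | insert k A hk ih =>
    have hsumm : AEMeasurable (∑ k ∈ A, W k) P := Finset.aemeasurable_sum A fun i _ => hWm i
    have hcard : (insert k A).card = A.card + 1 := Finset.card_insert_of_notMem hk
    have hle : (A.card : ℝ) + 1 ≤ B := by
      have h1 : (insert k A).card ≤ Fintype.card (Fin B) := Finset.card_le_univ _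
      rw [hcard, Fintype.card_fin] at h1
      exact_mod_cast h1
    have : IsProbabilityMeasure (P.map (W k)) := Measure.isProbabilityMeasure_map (hWm k)
    have : IsProbabilityMeasure (P.map (∑ k ∈ A, W k)) := Measure.isProbabilityMeasure_map hsumm
    have hlaw : P.map (∑ k ∈ insert k A, W k) = P.map (W k) ∗ P.map (∑ k ∈ A, W k) := by
      rw [Finset.sum_insert hk]
      exact (hind.indepFun_finsetSum_of_notMem₀ hWm hk).symm.map_add_eq_map_conv_map₀
        (hWm k) hsumm
    have hcoord : ∀ i, Measurable fun x : EuclideanSpace ℝ (Fin d) => x i := fun i => by fun_prop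
    have hqB : q ≤ 1 / 5 := by
      have : (0 : ℝ) ≤ A.card := Nat.cast_nonneg _
      nlinarith
    have hstep := coupledWithin_exchange (P.map (W k)) (s := s)
      (m := fun i => 1 - A.card * s i) hqB
      (fun i => by rw [integral_map (hWm k) (hcoord i).aestronglyMeasurable, hmean])
      (fun i j => by
        have hij : Measurable fun x : EuclideanSpace ℝ (Fin d) => x i * x j := by fun_prop
        rw [integral_map (hWm k) hij.aestronglyMeasurable, hcov])
      (by
        rw [ae_map_iff (hWm k) (measurableSet_le (by fun_prop) measurable_const)]
        exact hbdd k)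
      (fun i => by
        have h1 : (A.card : ℝ) * s i ≤ B * q :=
          mul_le_mul (by linarith) (hsq i) (hs0 i) (by positivity)
        linarith)
      (fun i => by
        have := mul_nonneg (Nat.cast_nonneg (α := ℝ) A.card) (hs0 i)
        linarith)
    have h1 := (hstep.conv (P.map (∑ k ∈ A, W k))).trans ih
    rw [Measure.conv_assoc, ← hlaw, ← ENNReal.ofReal_add (Real.sqrt_nonneg _) (by positivity)] at h1
    have h2 : (fun i => 1 - ((A.card + 1 : ℕ) : ℝ) * s i) = fun i => 1 - A.card * s i - s i := by
      funext i
      push_cast; ring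
    have h3 : ((A.card + 1 : ℕ) : ℝ) * √(2 * (5 / 4 * q) ^ 3)
        = √(2 * (5 / 4 * q) ^ 3) + A.card * √(2 * (5 / 4 * q) ^ 3) := by
      push_cast; ring
    rw [hcard, h2, h3]
    exact h1

/-! ### Diagonalization of the covariance matrix and conclusion -/

section Diagonalization

variable {d : ℕ} {S : Matrix (Fin d) (Fin d) ℝ} (hS : S.IsHermitian)

theorem dotProduct_mulVec_eigenvectorBasis (x : EuclideanSpace ℝ (Fin d)) (i : Fin d) :
    x.ofLp ⬝ᵥ S.mulVec (hS.eigenvectorBasis i).ofLp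
      = hS.eigenvalues i * hS.eigenvectorBasis.repr x i := by
  rw [hS.mulVec_eigenvectorBasis, dotProduct_smul, smul_eq_mul,
    hS.eigenvectorBasis.repr_apply_apply, EuclideanSpace.inner_eq_star_dotProduct]
  simp

theorem dotProduct_one_sub_mulVec (y : EuclideanSpace ℝ (Fin d)) :
    y.ofLp ⬝ᵥ (1 - S).mulVec y.ofLp
      = ∑ i, (1 - hS.eigenvalues i) * hS.eigenvectorBasis.repr y i ^ 2 := by
  set b := hS.eigenvectorBasis with hb
  rw [← Matrix.inner_toEuclideanCLM, ← b.sum_inner_mul_inner]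
  refine Finset.sum_congr rfl fun i _ => ?_
  have h1 : inner ℝ (b i) (Matrix.toEuclideanCLM (𝕜 := ℝ) (1 - S) y)
      = (1 - hS.eigenvalues i) * b.repr y i := by
    have h2 : (b i).ofLp ⬝ᵥ S.mulVec y.ofLp = y.ofLp ⬝ᵥ S.mulVec (b i).ofLp := by
      rw [Matrix.dotProduct_mulVec, ← Matrix.mulVec_transpose, dotProduct_comm]
      congr 2
    have h3 : (b i).ofLp ⬝ᵥ y.ofLp = b.repr y i := by
      rw [b.repr_apply_apply, EuclideanSpace.inner_eq_star_dotProduct, dotProduct_comm]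
      simp
    rw [Matrix.inner_toEuclideanCLM, Matrix.sub_mulVec, Matrix.one_mulVec, dotProduct_sub, h2, h3,
      hb, dotProduct_mulVec_eigenvectorBasis hS]
    ring
  rw [h1, real_inner_comm, ← b.repr_apply_apply]
  ring

/-- In the coordinates of an eigenbasis of `S`, the Gaussian measure with covariance matrix `1 - S`
has independent coordinates. -/
theorem map_repr_multivariateGaussian (h1 : ∀ i, hS.eigenvalues i ≤ 1) :
    (multivariateGaussian 0 (1 - S)).map hS.eigenvectorBasis.repr
      = diagGaussian fun i => 1 - hS.eigenvalues i := by
  set b := hS.eigenvectorBasis with hb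
  have hpsd : (1 - S).PosSemidef := by
    refine Matrix.PosSemidef.of_dotProduct_mulVec_nonneg (Matrix.isHermitian_one.sub hS) fun x => ?_
    have h2 := dotProduct_one_sub_mulVec hS (WithLp.toLp 2 x)
    simp only [star_trivial]
    change x ⬝ᵥ (1 - S).mulVec x = _ at h2
    rw [h2]
    exact Finset.sum_nonneg fun i _ => mul_nonneg (by linarith [h1 i]) (sq_nonneg _)
  have hbm : Measurable b.repr := b.repr.continuous.measurable
  have : IsProbabilityMeasure ((multivariateGaussian 0 (1 - S)).map b.repr) :=
    Measure.isProbabilityMeasure_map hbm.aemeasurable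
  refine Measure.ext_of_charFun ?_
  funext t
  have h2 : charFun ((multivariateGaussian 0 (1 - S)).map b.repr) t
      = charFun (multivariateGaussian 0 (1 - S)) (b.repr.symm t) := by
    rw [charFun_apply, charFun_apply, integral_map hbm.aemeasurable
      (Continuous.aestronglyMeasurable (by fun_prop))]
    congr 1
    funext x
    rw [← b.repr.inner_map_map x (b.repr.symm t), LinearIsometryEquiv.apply_symm_apply]
  rw [h2, charFun_multivariateGaussian hpsd, diagGaussian, charFun_pi]
  simp_rw [charFun_gaussianReal]
  rw [← Complex.exp_sum, dotProduct_one_sub_mulVec hS]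
  congr 1
  rw [← hb, LinearIsometryEquiv.apply_symm_apply]
  push_cast
  simp only [inner_zero_right, Complex.ofReal_zero, zero_mul, mul_zero, zero_sub,
    Finset.sum_neg_distrib, Finset.sum_div]
  congr 1
  refine Finset.sum_congr rfl fun i _ => ?_
  rw [Real.coe_toNNReal _ (by linarith [h1 i])]
  push_cast
  rfl

end Diagonalization

/-- Covariances of the coordinates of a bounded random vector in an eigenbasis of its covariance
matrix. -/
theorem integral_repr_mul_repr {Ω : Type*} [MeasurableSpace Ω] {P : Measure Ω}
    [IsProbabilityMeasure P] {d : ℕ} {S : Matrix (Fin d) (Fin d) ℝ} (hS : S.IsHermitian)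
    {Y : Ω → EuclideanSpace ℝ (Fin d)} (hYm : AEMeasurable Y P) {β : ℝ}
    (hcov : ∀ a b, ∫ ω, Y ω a * Y ω b ∂P = S a b) (hbdd : ∀ᵐ ω ∂P, ‖Y ω‖ ≤ β) (i j : Fin d) :
    HasIntegralValue P
      (fun ω => hS.eigenvectorBasis.repr (Y ω) i * hS.eigenvectorBasis.repr (Y ω) j)
      (if i = j then hS.eigenvalues i else 0) := by
  set b := hS.eigenvectorBasis with hb
  have hcoord : ∀ᵐ ω ∂P, ∀ a, ‖Y ω a‖ ≤ β := by
    filter_upwards [hbdd] with ω hω a using (PiLp.norm_apply_le (Y ω) a).trans hω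
  have hm : ∀ a, AEMeasurable (fun ω => Y ω a) P := fun a =>
    (by fun_prop : Measurable fun x : EuclideanSpace ℝ (Fin d) => x a).comp_aemeasurable hYm
  have h1 : ∀ a c, HasIntegralValue P (fun ω => Y ω a * Y ω c) (S a c) := fun a c => by
    refine ⟨Integrable.of_bound ((hm a).mul (hm c)).aestronglyMeasurable (β * β) ?_, hcov a c⟩
    filter_upwards [hcoord] with ω hω
    rw [norm_mul]
    exact mul_le_mul (hω a) (hω c) (norm_nonneg _) ((norm_nonneg _).trans (hω a))
  have hrepr : ∀ (y : EuclideanSpace ℝ (Fin d)) k, b.repr y k = ∑ a, b k a * y a := fun y k => by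
    rw [b.repr_apply_apply, EuclideanSpace.inner_eq_star_dotProduct, dotProduct_comm]
    simp [dotProduct]
  refine (HasIntegralValue.sum (s := Finset.univ) fun a _ =>
    HasIntegralValue.sum (s := Finset.univ) fun c _ => (h1 a c).const_mul (b i a * b j c)).congr
    (fun ω => ?_) ?_
  · rw [hrepr, hrepr, Finset.sum_mul_sum]
    exact Finset.sum_congr rfl fun a _ => Finset.sum_congr rfl fun c _ => by ring
  · have h2 := dotProduct_mulVec_eigenvectorBasis hS (b i) j
    rw [← hb, b.repr_self] at h2
    simp only [dotProduct, Matrix.mulVec] at h2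
    have h3 : ∑ a, ∑ c, b i a * b j c * S a c = ∑ a, b i a * ∑ c, S a c * b j c := by
      refine Finset.sum_congr rfl fun a _ => ?_
      rw [Finset.mul_sum]
      exact Finset.sum_congr rfl fun c _ => by ring
    rw [h3, h2]
    by_cases hij : i = j
    · simp [hij]
    · have hji : j ≠ i := fun h => hij h.symm
      simp [hij, hji]

/-- The total cost of `B` exchanges with the bound `β ^ 2 / B` on the squared norm of a summand is
`(125 / 32) β ^ 6 / B`. -/
theorem exchange_cost_le {d B : ℕ} (hd : 1 ≤ d) (hB : 1 ≤ B) {β : ℝ} :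
    (B * √(2 * (5 / 4 * (β ^ 2 / B)) ^ 3)) ^ 2
      ≤ 25 * β ^ 6 * d * (1 + Real.log B) ^ 2 / B := by
  have hB' : (1 : ℝ) ≤ B := by exact_mod_cast hB
  have hd' : (1 : ℝ) ≤ d := by exact_mod_cast hd
  have hlog : 1 ≤ (1 + Real.log B) ^ 2 := by
    have := Real.log_nonneg hB'
    nlinarith
  have hβ : 0 ≤ β ^ 6 := by positivity
  rw [mul_pow, Real.sq_sqrt (by positivity)]
  have h1 : (B : ℝ) ^ 2 * (2 * (5 / 4 * (β ^ 2 / B)) ^ 3) = 125 / 32 * β ^ 6 / B := by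
    field_simp
    ring
  rw [h1]
  refine div_le_div_of_nonneg_right ?_ (by linarith)
  calc 125 / 32 * β ^ 6 ≤ 25 * β ^ 6 * 1 * 1 := by linarith
    _ ≤ 25 * β ^ 6 * d * (1 + Real.log B) ^ 2 := by
        refine mul_le_mul (mul_le_mul_of_nonneg_left hd' (by positivity)) hlog zero_le_one
          (by positivity)

theorem mainTheorem5 {Ω : Type*} [MeasurableSpace Ω] (P : Measure Ω) [IsProbabilityMeasure P]
    (d B : ℕ) (hB : 1 ≤ B) (β : ℝ)
    (S : Matrix (Fin d) (Fin d) ℝ)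
    (Y : Fin B → Ω → EuclideanSpace ℝ (Fin d))
    (X Z : Ω → EuclideanSpace ℝ (Fin d))
    -- the `Y i` are i.i.d., centred, with covariance matrix `S`, and bounded by `β`
    (hY_indep : iIndepFun Y P)
    (hY_ident : ∀ i j, IdentDistrib (Y i) (Y j) P P)
    (hY_mean : ∀ i, ∫ ω, Y i ω ∂P = 0)
    (hY_cov : ∀ i a b, ∫ ω, Y i ω a * Y i ω b ∂P = S a b)
    (hY_bdd : ∀ i, ∀ᵐ ω ∂P, ‖Y i ω‖ ≤ β)
    -- `X` and `Z` are i.i.d. standard Gaussian, independent of the `Y i`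
    (hX : HasLaw X (stdGaussian (EuclideanSpace ℝ (Fin d))) P)
    (hZ : HasLaw Z (stdGaussian (EuclideanSpace ℝ (Fin d))) P)
    (hXZ : IndepFun X Z P)
    (hXZY : IndepFun (fun ω => (X ω, Z ω)) (fun ω i => Y i ω) P)
    -- the size conditions; the norm of `S` is the spectral norm
    (hβ : β ^ 2 ≤ 1 / 5)
    (hS : ‖Matrix.toEuclideanCLM (𝕜 := ℝ) S‖ ≤ 1 / (5 * (d : ℝ))) :
    wassersteinDist 2
        (P.map fun ω => Matrix.toEuclideanCLM (𝕜 := ℝ) (CFC.sqrt (1 - S)) (X ω)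
          + (1 / √(B : ℝ)) • ∑ i, Y i ω)
        (P.map Z) ^ 2
      ≤ ENNReal.ofReal (25 * β ^ 6 * d * (1 + Real.log B) ^ 2 / B) := by
  have hbound : ∀ {c : ℝ≥0∞} {μ : Measure (EuclideanSpace ℝ (Fin d))} {r : ℝ},
      CoupledWithin c μ (P.map Z) → c ^ 2 ≤ ENNReal.ofReal r →
      wassersteinDist 2 μ (P.map Z) ^ 2 ≤ ENNReal.ofReal r := fun h hc =>
    (pow_le_pow_left₀ zero_le h.wassersteinDist_le 2).trans hc
  -- in dimension zero the bound vanishes and the two random vectors coincide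
  rcases Nat.eq_zero_or_pos d with hd | hd
  · subst hd
    have h1 : (fun ω => Matrix.toEuclideanCLM (𝕜 := ℝ) (CFC.sqrt (1 - S)) (X ω)
        + (1 / √(B : ℝ)) • ∑ i, Y i ω) = Z := funext fun _ => Subsingleton.elim _ _
    rw [h1]
    exact hbound (CoupledWithin.refl 0 _) (by simp)
  have hB0 : (0 : ℝ) < B := by exact_mod_cast hB
  have hYm : ∀ i, AEMeasurable (Y i) P := fun i => (hY_ident i i).aemeasurable_fst
  have hS' : S.IsHermitian := by
    ext a b
    rw [Matrix.conjTranspose_apply, star_trivial, ← hY_cov ⟨0, hB⟩, ← hY_cov ⟨0, hB⟩]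
    simp_rw [mul_comm]
  set b := hS'.eigenvectorBasis with hb
  set ev := hS'.eigenvalues with hev
  have hbm : Measurable b.repr := b.repr.continuous.measurable
  have hcov := fun k => integral_repr_mul_repr hS' (hYm k) (hY_cov k) (hY_bdd k)
  rw [← hb, ← hev] at hcov
  have hnorm : ∀ y : EuclideanSpace ℝ (Fin d), ∑ i, b.repr y i ^ 2 = ‖y‖ ^ 2 := fun y => by
    rw [← EuclideanSpace.real_norm_sq_eq, b.repr.norm_map]
  have hsq : ∀ k, ∀ᵐ ω ∂P, ∑ i, b.repr (Y k ω) i ^ 2 ≤ β ^ 2 := fun k => by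
    filter_upwards [hY_bdd k] with ω hω
    rw [hnorm]
    exact pow_le_pow_left₀ (norm_nonneg _) hω 2
  have hev0 : ∀ i, 0 ≤ ev i := fun i => by
    have h1 := (hcov ⟨0, hB⟩ i i).2
    rw [if_pos rfl] at h1
    rw [← h1]
    exact integral_nonneg fun ω => mul_self_nonneg _
  have hev1 : ∀ i, ev i ≤ β ^ 2 := fun i => by
    have h1 := hcov ⟨0, hB⟩ i i
    rw [if_pos rfl] at h1
    rw [← h1.2]
    calc _ ≤ ∫ _, β ^ 2 ∂P := integral_mono_ae h1.1 (integrable_const _) (by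
          filter_upwards [hsq ⟨0, hB⟩] with ω hω
          have h2 := Finset.single_le_sum (f := fun i => b.repr (Y ⟨0, hB⟩ ω) i ^ 2)
            (fun i _ => sq_nonneg _) (Finset.mem_univ i)
          rw [← sq]
          exact h2.trans hω)
      _ = β ^ 2 := by simp
  -- the summands, scaled and expressed in the eigenbasis
  set r : ℝ := 1 / √(B : ℝ) with hr
  have hrr : r * r = 1 / B := by
    rw [hr, div_mul_div_comm, one_mul, Real.mul_self_sqrt hB0.le]
  set g : EuclideanSpace ℝ (Fin d) → EuclideanSpace ℝ (Fin d) := fun y => b.repr (r • y) with hg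
  have hgm : Measurable g := hbm.comp (measurable_const_smul r)
  have hgi : ∀ y i, g y i = r * b.repr y i := fun y i => by simp [hg]
  set W : Fin B → Ω → EuclideanSpace ℝ (Fin d) := fun k => g ∘ Y k with hW
  have hmain := coupledWithin_sum (W := W) (s := fun i => ev i / B) (q := β ^ 2 / B)
    (hY_indep.comp (fun _ => g) fun _ => hgm) (fun k => hgm.comp_aemeasurable (hYm k))
    (by positivity) (by rw [mul_div_cancel₀ _ hB0.ne']; exact hβ)
    (fun k i => by
      have hint : Integrable (Y k) P := Integrable.of_bound (hYm k).aestronglyMeasurable β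
        (hY_bdd k)
      simp only [hW, Function.comp, hgi, b.repr_apply_apply]
      rw [integral_const_mul, integral_inner hint, hY_mean, inner_zero_right, mul_zero])
    (fun k i j => by
      refine (((hcov k i j).const_mul (r * r)).congr (g := fun ω => W k ω i * W k ω j)
        (fun ω => ?_) ?_).2
      · simp only [hW, Function.comp, hgi]; ring
      · rw [hrr]; split_ifs <;> ring)
    (fun k => by
      filter_upwards [hsq k] with ω hω
      simp only [hW, Function.comp, hgi, mul_pow]
      rw [← Finset.mul_sum, sq r, hrr, div_eq_inv_mul, div_eq_inv_mul, mul_one]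
      exact mul_le_mul_of_nonneg_left hω (by positivity))
    (fun i => div_nonneg (hev0 i) hB0.le)
    (fun i => div_le_div_of_nonneg_right (hev1 i) hB0.le) Finset.univ
  rw [Finset.card_univ, Fintype.card_fin] at hmain
  -- the law in question, expressed in the eigenbasis
  set T := Matrix.toEuclideanCLM (𝕜 := ℝ) (CFC.sqrt (1 - S)) with hT
  set V : Ω → EuclideanSpace ℝ (Fin d) := fun ω => r • ∑ i, Y i ω with hV
  have hXm := hX.aemeasurable
  have hTm : Measurable T := T.continuous.measurable
  have hVm : AEMeasurable V P := by
    have h1 : AEMeasurable (fun ω => ∑ i, Y i ω) P := Finset.aemeasurable_fun_sum _ fun i _ => hYm i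
    exact h1.const_smul r
  have hTX : P.map (fun ω => T (X ω)) = multivariateGaussian 0 (1 - S) := by
    have h1 : (fun ω => T (X ω)) = T ∘ X := rfl
    rw [h1, ← AEMeasurable.map_map_of_aemeasurable hTm.aemeasurable hXm, hX.map_eq,
      multivariateGaussian]
    simp [hT]
  have hind : IndepFun (fun ω => T (X ω)) V P :=
    hXZY.comp (φ := fun x : EuclideanSpace ℝ (Fin d) × EuclideanSpace ℝ (Fin d) => T x.1)
      (ψ := fun y : Fin B → EuclideanSpace ℝ (Fin d) => r • ∑ i, y i)
      (hTm.comp measurable_fst) (by fun_prop)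
  have : IsProbabilityMeasure (P.map V) := Measure.isProbabilityMeasure_map hVm
  have hlaw : P.map (fun ω => T (X ω) + V ω) = multivariateGaussian 0 (1 - S) ∗ P.map V := by
    rw [← hTX]
    exact hind.map_add_eq_map_conv_map₀ (hTm.comp_aemeasurable hXm) hVm
  have hVW : (P.map V).map b.repr = P.map (∑ k, W k) := by
    rw [AEMeasurable.map_map_of_aemeasurable hbm.aemeasurable hVm]
    congr 1
    funext ω
    simp only [hV, hW, hg, Function.comp, Finset.sum_apply, Finset.smul_sum, map_sum]
  have hrepr : (P.map fun ω => T (X ω) + V ω).map b.repr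
      = diagGaussian (fun i => 1 - B * (ev i / B)) ∗ P.map (∑ k, W k) := by
    have h1 := Measure.map_conv_continuousLinearMap (μ := multivariateGaussian 0 (1 - S))
      (ν := P.map V) b.repr.toContinuousLinearEquiv.toContinuousLinearMap
    have h2 : (fun i => 1 - B * (ev i / B)) = fun i => 1 - ev i := by
      funext i
      rw [mul_div_cancel₀ _ hB0.ne']
    rw [hlaw, h2, ← hVW, hev,
      ← map_repr_multivariateGaussian hS' fun i => (hev1 i).trans (by linarith)]
    exact h1
  rw [← hrepr] at hmain
  have hback := hmain.map (f := b.repr.symm) b.repr.symm.continuous.measurable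
    fun x y => (b.repr.symm.edist_map x y).le
  rw [stdGaussian_map, Measure.map_map b.repr.symm.continuous.measurable hbm, ← hZ.map_eq] at hback
  have hid : b.repr.symm ∘ b.repr = id := funext fun x => b.repr.symm_apply_apply x
  rw [hid, Measure.map_id] at hback
  refine hbound hback ?_
  rw [← ENNReal.ofReal_pow (by positivity)]
  exact ENNReal.ofReal_le_ofReal (exchange_cost_le hd hB)
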